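/- **Setting.** Forests are ordered, with nodes labelled by symbols from $\{0,\dots,\sigma-1\}$; $|F|$ is the number of nodes of $F$. The edit distance $\mathsf{ed}(F,G)$ is the least total number of operations on $F$ and on $G$ that make them identical, an operation being either changing the label of a node or removing a node (its children become, in the same order, children of its parent), and $\mathsf{sim}(F,G)=|F|+|G|-\mathsf{ed}(F,G)$. The bi-order traversal sequence of $G$ lists the nodes in depth-first order, writing each node when it is entered and again when it is left. For $1\le i\le j\le 2|G|+1$, $G[i,j)$ is the forest obtained from $G$ by removing all nodes that occur among the entries $1,\dots,i-1$ or $j,\dots,2|G|$ of this sequence. The similarity matrix $S(F,G)$ is the $(2|G|+1)\times(2|G|+1)$ matrix whose $(i,j)$ entry is $\mathsf{sim}(F,G[i,j))$ if $i\le j$, and $-\infty$ if $i>j$. **Model.** The algorithm runs on a word RAM (addition, truncated subtraction, multiplication, array access, branching and loops, one unit of time for every elementary step) that can moreover store matrices with entries in $\mathbb N\cup\{-\infty\}$, but accesses them only through the following range operations and queries, each of which takes time $\tau(N)$, in addition to the elementary steps for its arguments: produce an $n\times m$ matrix with all entries $-\infty$; copy a matrix; given $A,i',j',x$, produce $\mathsf{rangemax}(A,i',j',x)$,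 which is $A$ with $a_{ij}$ replaced by $\max(a_{ij},x)$ for all $i\le i'$, $j\ge j'$; query $a_{ij}$; query $\mathsf{mincol}(A,i,x)=\min\{j: a_{ij}\ge x\}$ or $\mathsf{maxrow}(A,j,x)=\max\{i: a_{ij}\ge x\}$, where an arbitrary valid index is returned if there is no such $j$ or $i$. The input $(F,T_2)$ is given by the two bi-order traversals (with the label of each entered node and a marker for each exit). A function $g$ is $N^{o(1)}$ if $g(N)=O(N^{\varepsilon})$ for every $\varepsilon>0$. **Theorem.** There are one program in this model and constants $c,k$ such that the following holds. For every $\tau(N)=N^{o(1)}$ there is a function $g(N)=N^{o(1)}$ such that for all $\sigma$, all forests $F$ and $T_2$ with labels in $\{0,\dots,\sigma-1\}$ (in particular for every tree $T_2$), and all choices of the answers that the queries leave open, the program, using only words with values at most $c\,(|F|+|T_2|+\sigma+1)^k$, halts with the matrix $S(F,T_2)$ stored in the model and with the number $\mathsf{ed}(F,T_2)$ as output, after time at most $$g(|F|+|T_2|)\cdot \max(|F|,1)^2\cdot\max(|T_2|,1).$$ That is, $S(F)=S(F,T_2)$ is computed, and the edit distance with it, in $\tilde O(|F|^2|T_2|)$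 time. -/

import Mathlib

/-! Ordered labelled forests, tree edit distance, similarity matrices, and a word RAM
extended with implicitly stored matrices. -/

namespace TED

/-! ### Forests and edit distance -/

/-- Ordered forests with node labels in `α`: either the empty forest, or a leftmost tree with root
label `a` and forest of children `c`, followed by the forest `r` of the remaining trees. -/
inductive Forest (α : Type) : Type
  | nil : Forest α
  | cons (a : α) (c r : Forest α) : Forest α

namespace Forest

variable {α β : Type}

/-- The number of nodes. -/
def size : Forest α → ℕ
  | nil => 0
  | cons _ c r => c.size + r.size + 1

/-- Concatenation of two forests from left to right. -/
def append : Forest α → Forest α → Forest α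
  | nil, G => G
  | cons a c r, G => cons a c (r.append G)

/-- Apply a function to all labels. -/
def map (f : α → β) : Forest α → Forest β
  | nil => nil
  | cons a c r => cons (f a) (c.map f) (r.map f)

/-- The bi-order traversal sequence: every node is written when the depth-first traversal enters
it, and once more when the traversal leaves it. -/
def biorder : Forest α → List α
  | nil => []
  | cons a c r => a :: (c.biorder ++ a :: r.biorder)

/-- Give the nodes pairwise distinct names: a node is named by the time at which the depth-first
traversal enters it, when the traversal starts at time `t`. -/
def name : ℕ → Forest α → Forest (ℕ × α)
  | _, nil => nil
  | t, cons a c r => cons (t, a) (name (t + 1) c) (name (t + 2 * c.size + 2) r)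

/-- Apply the node removal operation to all nodes that do not satisfy `p`: a removed node is
replaced by the sequence of its children. -/
def keep (p : α → Prop) [DecidablePred p] : Forest α → Forest α
  | nil => nil
  | cons a c r =>
      if p a then cons a (c.keep p) (r.keep p) else (c.keep p).append (r.keep p)

/-- The subforest `F[l, r)` for `1 ≤ l ≤ r ≤ 2 |F| + 1`: remove from `F` all nodes that appear at
least once among the entries `1, …, l - 1` or among the entries `r, …, 2 |F|` of the bi-order
traversal sequence. -/
def sub (F : Forest α) (l r : ℕ) : Forest α :=
  ((F.name 1).keep fun u =>
    u.1 ∉ ((F.name 1).biorder.map Prod.fst).take (l - 1) ∧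
    u.1 ∉ ((F.name 1).biorder.map Prod.fst).drop (r - 1)).map Prod.snd

end Forest

/-- One edit operation on a forest: give a node another label, or remove a node, its children
becoming children of its parent in the same order. -/
inductive EditStep {α : Type} : Forest α → Forest α → Prop
  | relabel (a b : α) (c r : Forest α) (h : a ≠ b) : EditStep (.cons a c r) (.cons b c r)
  | delete (a : α) (c r : Forest α) : EditStep (.cons a c r) (c.append r)
  | child (a : α) (c c' r : Forest α) (h : EditStep c c') :
      EditStep (.cons a c r) (.cons a c' r)
  | sibling (a : α) (c r r' : Forest α) (h : EditStep r r') :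
      EditStep (.cons a c r) (.cons a c r')

/-- `EditSteps k F H`: exactly `k` edit operations, one after the other, turn `F` into `H`. -/
inductive EditSteps {α : Type} : ℕ → Forest α → Forest α → Prop
  | refl (F : Forest α) : EditSteps 0 F F
  | step {k : ℕ} {F G H : Forest α} (h : EditStep F G) (hs : EditSteps k G H) :
      EditSteps (k + 1) F H

/-- The tree edit distance: the least total number of edit operations on `F` and on `G` that make
them identical. -/
noncomputable def ed {α : Type} (F G : Forest α) : ℕ :=
  sInf {k | ∃ (i j : ℕ) (H : Forest α), i + j = k ∧ EditSteps i F H ∧ EditSteps j G H}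

theorem Forest.size_append {α : Type} (F G : Forest α) :
    (F.append G).size = F.size + G.size := by
  induction F with
  | nil => simp [Forest.append, Forest.size]
  | cons a c r _ ih => simp only [Forest.append, Forest.size, ih]; omega

theorem editSteps_nil {α : Type} (n : ℕ) (F : Forest α) (h : F.size = n) :
    EditSteps n F .nil := by
  induction n generalizing F with
  | zero =>
    cases F with
    | nil => exact .refl _
    | cons a c r => simp [Forest.size] at h
  | succ n ih =>
    cases F with
    | nil => simp [Forest.size] at h
    | cons a c r =>
      refine .step (.delete a c r) (ih _ ?_)
      rw [Forest.size_append]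
      simp only [Forest.size] at h
      omega

/-- The minimum in `ed` is over a non-empty set, and the subtraction in `sim` does not truncate. -/
theorem ed_le {α : Type} (F G : Forest α) : ed F G ≤ F.size + G.size :=
  Nat.sInf_le ⟨F.size, G.size, .nil, rfl, editSteps_nil _ F rfl, editSteps_nil _ G rfl⟩

/-- The similarity of two forests. -/
noncomputable def sim {α : Type} (F G : Forest α) : ℕ := F.size + G.size - ed F G

/-! ### Matrices, range operations and range queries -/

/-- A `rows × cols` matrix with entries in `ℕ ∪ {-∞}`. Rows and columns are numbered from `1`;
only the values of `entry` at indices in `[1, rows] × [1, cols]` are meaningful. -/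
structure Mat where
  rows : ℕ
  cols : ℕ
  entry : ℕ → ℕ → WithBot ℕ

namespace Mat

/-- `(i, j)` is a position of the matrix. -/
def InRange (A : Mat) (i j : ℕ) : Prop := (1 ≤ i ∧ i ≤ A.rows) ∧ (1 ≤ j ∧ j ≤ A.cols)

/-- Equality of matrices: equal dimensions and equal entries at all positions. -/
def Same (A B : Mat) : Prop :=
  A.rows = B.rows ∧ A.cols = B.cols ∧ ∀ i j, A.InRange i j → A.entry i j = B.entry i j

/-- The `n × m` matrix with all entries `-∞`. -/
def bot (n m : ℕ) : Mat := ⟨n, m, fun _ _ => ⊥⟩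

/-- `rangemax(A, i', j', x)`. -/
def rangemax (A : Mat) (i' j' : ℕ) (x : WithBot ℕ) : Mat :=
  { A with entry := fun i j => if i ≤ i' ∧ j' ≤ j then max (A.entry i j) x else A.entry i j }

/-- `mincol(A, i, x) = min {j | A i j ≥ x}`, and some index determined by `d`, which can be any
index in `[1, cols]`, if there is no such `j`. -/
def mincol (A : Mat) (d i : ℕ) (x : WithBot ℕ) : ℕ :=
  if h : ((Finset.Icc 1 A.cols).filter fun j => x ≤ A.entry i j).Nonempty then
    ((Finset.Icc 1 A.cols).filter fun j => x ≤ A.entry i j).min' h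
  else d % A.cols + 1

/-- `maxrow(A, j, x) = max {i | A i j ≥ x}`, and some index determined by `d`, which can be any
index in `[1, rows]`, if there is no such `i`. -/
def maxrow (A : Mat) (d j : ℕ) (x : WithBot ℕ) : ℕ :=
  if h : ((Finset.Icc 1 A.rows).filter fun i => x ≤ A.entry i j).Nonempty then
    ((Finset.Icc 1 A.rows).filter fun i => x ≤ A.entry i j).max' h
  else d % A.rows + 1

end Mat

/-- The similarity matrix `S(F, G)`, of dimensions `(2 |G| + 1) × (2 |G| + 1)`. -/
noncomputable def simMatrix {α : Type} (F G : Forest α) : Mat where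
  rows := 2 * G.size + 1
  cols := 2 * G.size + 1
  entry i j := if i ≤ j then (sim F (G.sub i j) : WithBot ℕ) else ⊥

/-! ### The machine

A word RAM whose memory consists of scalar variables and arrays of words, extended by a memory of
matrices that is accessed only through the range operations and the range queries (so that all
matrices produced are row-monotone and column-monotone). A word is a natural number that is at most
`W`. -/

/-- A word that stands for an element of `ℕ ∪ {-∞}`: `0` for `-∞`, and `x + 1` for `x`. -/
def encode (x : WithBot ℕ) : ℕ := x.recBotCoe 0 (fun n => n + 1)

/-- The element of `ℕ ∪ {-∞}` that a word stands for. -/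
def decode : ℕ → WithBot ℕ
  | 0 => ⊥
  | n + 1 => (n : WithBot ℕ)

/-- The contents of the memory, the number `steps` of elementary steps made so far, and the number
`ops` of range operations and range queries made so far. -/
structure State where
  var : ℕ → ℕ
  arr : ℕ → ℕ → ℕ
  mat : ℕ → Mat
  steps : ℕ
  ops : ℕ

namespace State

/-- Charge `n` elementary steps. -/
def tick (s : State) (n : ℕ) : State := { s with steps := s.steps + n }

/-- Charge `n` elementary steps and one range operation or range query. -/
def tickOp (s : State) (n : ℕ) : State := { s with steps := s.steps + n, ops := s.ops + 1 }

/-- Write the variable `x`. -/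
def setVar (s : State) (x v : ℕ) : State := { s with var := Function.update s.var x v }

/-- Write entry `i` of the array `a`. -/
def setArr (s : State) (a i v : ℕ) : State :=
  { s with arr := Function.update s.arr a (Function.update (s.arr a) i v) }

/-- Write cell `h` of the matrix memory. -/
def setMat (s : State) (h : ℕ) (A : Mat) : State := { s with mat := Function.update s.mat h A }

end State

/-- Arithmetic expressions. A program names variables and arrays by constants; array indices are
computed. Subtraction is truncated at `0`. -/
inductive Expr : Type
  | const (n : ℕ) : Expr
  | var (x : ℕ) : Expr
  | arr (a : ℕ) (e : Expr) : Expr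
  | add (e f : Expr) : Expr
  | sub (e f : Expr) : Expr
  | mul (e f : Expr) : Expr

namespace Expr

/-- The value of an expression. -/
def eval (s : State) : Expr → ℕ
  | const n => n
  | var x => s.var x
  | arr a e => s.arr a (e.eval s)
  | add e f => e.eval s + f.eval s
  | sub e f => e.eval s - f.eval s
  | mul e f => e.eval s * f.eval s

/-- The number of elementary steps for evaluating an expression: one for every constituent. -/
def cost : Expr → ℕ
  | const _ => 1
  | var _ => 1
  | arr _ e => e.cost + 1
  | add e f => e.cost + f.cost + 1
  | sub e f => e.cost + f.cost + 1
  | mul e f => e.cost + f.cost + 1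

/-- All values that occur in the evaluation of the expression are words. -/
def Fits (W : ℕ) (s : State) : Expr → Prop
  | const n => n ≤ W
  | var x => s.var x ≤ W
  | arr a e => e.Fits W s ∧ s.arr a (e.eval s) ≤ W
  | add e f => e.Fits W s ∧ f.Fits W s ∧ e.eval s + f.eval s ≤ W
  | sub e f => e.Fits W s ∧ f.Fits W s
  | mul e f => e.Fits W s ∧ f.Fits W s ∧ e.eval s * f.eval s ≤ W

end Expr

/-- Programs. -/
inductive Cmd : Type
  /-- Variable `x := e`. -/
  | assign (x : ℕ) (e : Expr) : Cmd
  /-- Entry `i` of array `a` `:= e`. -/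
  | store (a : ℕ) (i e : Expr) : Cmd
  /-- Matrix cell `h :=` the `n × m` matrix with all entries `-∞`. -/
  | newMat (h n m : Expr) : Cmd
  /-- Matrix cell `h :=` the matrix in cell `g`. -/
  | copyMat (h g : Expr) : Cmd
  /-- Matrix cell `h := rangemax(A, i, j, x)`, where `A` is in cell `g` and `x` is encoded. -/
  | rangemax (h g i j x : Expr) : Cmd
  /-- Variable `y :=` the code of entry `(i, j)` of the matrix in cell `g`. -/
  | entry (y : ℕ) (g i j : Expr) : Cmd
  /-- Variable `y := mincol(A, i, x)`, where `A` is in cell `g` and `x` is encoded. -/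
  | mincol (y : ℕ) (g i x : Expr) : Cmd
  /-- Variable `y := maxrow(A, j, x)`, where `A` is in cell `g` and `x` is encoded. -/
  | maxrow (y : ℕ) (g j x : Expr) : Cmd
  /-- First `p`, then `q`. -/
  | seq (p q : Cmd) : Cmd
  /-- If `e ≠ 0` then `p` else `q`. -/
  | cond (e : Expr) (p q : Cmd) : Cmd
  /-- While `e ≠ 0` do `p`. -/
  | loop (e : Expr) (p : Cmd) : Cmd

/-- `Exec W adv p s t`: with words up to `W`, the program `p` started in the state `s` halts in the
state `t`, without exceeding the word size and without a range operation or range query at an index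
out of range. Where a range query leaves its answer open, the answer is settled by `adv`, applied
to the number of range operations and range queries made before. -/
inductive Exec (W : ℕ) (adv : ℕ → ℕ) : Cmd → State → State → Prop
  | assign {x : ℕ} {e : Expr} {s : State} (he : e.Fits W s) :
      Exec W adv (.assign x e) s ((s.setVar x (e.eval s)).tick (e.cost + 1))
  | store {a : ℕ} {i e : Expr} {s : State} (hi : i.Fits W s) (he : e.Fits W s) :
      Exec W adv (.store a i e) s
        ((s.setArr a (i.eval s) (e.eval s)).tick (i.cost + e.cost + 1))
  | newMat {h n m : Expr} {s : State} (hh : h.Fits W s) (hn : n.Fits W s) (hm : m.Fits W s) :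
      Exec W adv (.newMat h n m) s
        ((s.setMat (h.eval s) (Mat.bot (n.eval s) (m.eval s))).tickOp
          (h.cost + n.cost + m.cost + 1))
  | copyMat {h g : Expr} {s : State} (hh : h.Fits W s) (hg : g.Fits W s) :
      Exec W adv (.copyMat h g) s
        ((s.setMat (h.eval s) (s.mat (g.eval s))).tickOp (h.cost + g.cost + 1))
  | rangemax {h g i j x : Expr} {s : State} (hh : h.Fits W s) (hg : g.Fits W s)
      (hi : i.Fits W s) (hj : j.Fits W s) (hx : x.Fits W s)
      (hr : (s.mat (g.eval s)).InRange (i.eval s) (j.eval s)) :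
      Exec W adv (.rangemax h g i j x) s
        ((s.setMat (h.eval s)
          ((s.mat (g.eval s)).rangemax (i.eval s) (j.eval s) (decode (x.eval s)))).tickOp
          (h.cost + g.cost + i.cost + j.cost + x.cost + 1))
  | entry {y : ℕ} {g i j : Expr} {s : State} (hg : g.Fits W s) (hi : i.Fits W s)
      (hj : j.Fits W s) (hr : (s.mat (g.eval s)).InRange (i.eval s) (j.eval s)) :
      Exec W adv (.entry y g i j) s
        ((s.setVar y (encode ((s.mat (g.eval s)).entry (i.eval s) (j.eval s)))).tickOp
          (g.cost + i.cost + j.cost + 1))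
  | mincol {y : ℕ} {g i x : Expr} {s : State} (hg : g.Fits W s) (hi : i.Fits W s)
      (hx : x.Fits W s) (hr : (s.mat (g.eval s)).InRange (i.eval s) 1) :
      Exec W adv (.mincol y g i x) s
        ((s.setVar y
          ((s.mat (g.eval s)).mincol (adv s.ops) (i.eval s) (decode (x.eval s)))).tickOp
          (g.cost + i.cost + x.cost + 1))
  | maxrow {y : ℕ} {g j x : Expr} {s : State} (hg : g.Fits W s) (hj : j.Fits W s)
      (hx : x.Fits W s) (hr : (s.mat (g.eval s)).InRange 1 (j.eval s)) :
      Exec W adv (.maxrow y g j x) s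
        ((s.setVar y
          ((s.mat (g.eval s)).maxrow (adv s.ops) (j.eval s) (decode (x.eval s)))).tickOp
          (g.cost + j.cost + x.cost + 1))
  | seq {p q : Cmd} {s t u : State} (hp : Exec W adv p s t) (hq : Exec W adv q t u) :
      Exec W adv (.seq p q) s u
  | condTrue {e : Expr} {p q : Cmd} {s t : State} (he : e.Fits W s) (h : e.eval s ≠ 0)
      (hp : Exec W adv p (s.tick (e.cost + 1)) t) : Exec W adv (.cond e p q) s t
  | condFalse {e : Expr} {p q : Cmd} {s t : State} (he : e.Fits W s) (h : e.eval s = 0)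
      (hq : Exec W adv q (s.tick (e.cost + 1)) t) : Exec W adv (.cond e p q) s t
  | loopTrue {e : Expr} {p : Cmd} {s t u : State} (he : e.Fits W s) (h : e.eval s ≠ 0)
      (hp : Exec W adv p (s.tick (e.cost + 1)) t) (hl : Exec W adv (.loop e p) t u) :
      Exec W adv (.loop e p) s u
  | loopFalse {e : Expr} {p : Cmd} {s : State} (he : e.Fits W s) (h : e.eval s = 0) :
      Exec W adv (.loop e p) s (s.tick (e.cost + 1))

/-- The machine is deterministic once `adv` is fixed. -/
theorem Exec.unique {W : ℕ} {adv : ℕ → ℕ} {p : Cmd} {s t u : State} (h : Exec W adv p s t)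
    (h' : Exec W adv p s u) : t = u := by
  induction h generalizing u with
  | seq _ _ ih₁ ih₂ =>
    cases h' with
    | seq hp hq => exact ih₂ (ih₁ hp ▸ hq)
  | condTrue _ h _ ih =>
    cases h' with
    | condTrue _ _ hp => exact ih hp
    | condFalse _ h₀ _ => exact absurd h₀ h
  | condFalse _ h _ ih =>
    cases h' with
    | condTrue _ h₀ _ => exact absurd h h₀
    | condFalse _ _ hq => exact ih hq
  | loopTrue _ h _ _ ih₁ ih₂ =>
    cases h' with
    | loopTrue _ _ hp hl => exact ih₂ (ih₁ hp ▸ hl)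
    | loopFalse _ h₀ => exact absurd h₀ h
  | loopFalse _ h =>
    cases h' with
    | loopTrue _ h₀ _ _ => exact absurd h h₀
    | loopFalse _ _ => rfl
  | _ => cases h'; rfl

/-- The input encoding of a forest with labels `0, …, σ - 1`: its bi-order traversal, where
entering a node with label `a` is written `a + 1` and leaving a node is written `0`. -/
def tokens {σ : ℕ} : Forest (Fin σ) → List ℕ
  | .nil => []
  | .cons a c r => (a.val + 1) :: (tokens c ++ 0 :: tokens r)

/-- The initial state for the input `(F, G)`: arrays `0` and `1` hold the encodings of `F` and of
`G` from index `0` on, variables `0` and `1` hold their lengths, all other words are `0`, and no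
matrix has been produced. -/
def initState {σ : ℕ} (F G : Forest (Fin σ)) : State where
  var x := if x = 0 then (tokens F).length else if x = 1 then (tokens G).length else 0
  arr a i := if a = 0 then (tokens F).getD i 0 else if a = 1 then (tokens G).getD i 0 else 0
  mat _ := Mat.bot 0 0
  steps := 0
  ops := 0

/-- `g n = n ^ o(1)`: the factors that are hidden by the notation `Õ`. -/
def SubPoly (g : ℕ → ℝ) : Prop :=
  ∀ ε : ℝ, 0 < ε → g =O[Filter.atTop] fun n : ℕ => (n : ℝ) ^ ε

end TED

/-!
The program computes the similarity matrices of subforests of `F` by dynamic programming, bottom-up.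

*Recursion.* A matching of `F` with `G` of weight at least `s` can be built from the left by
deleting leftmost roots and by matching two leftmost roots (`Matching`). The edit distance is the
minimum over pairs of sequences of edit operations, but `sim F G` is the largest weight of such a
matching (`matching_iff_le_sim`), since one operation changes the number of nodes minus the weight of
a best matching by at most one (`Matching.of_editStep`). What remains of `G[i, j)` below its leftmost
root, and what remains to the right of it, lies between two positions of the traversal again
(`Forest.between_eq_nil_or_cons`), so that induction on matchings gives two rules. The matrix of a
concatenation is the max-plus product of the matrices of its parts (`Matching.exists_split`). The
matrix of a tree is obtained from the matrix of the forest below its root by one range update for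
every node of `G` (`matching_tree_iff`).

*Products.* All entries are `-∞` or at most `2 |F|`, and the matrices are monotone in both indices.
So a row has few values, and for each value only the first column that reaches it matters, which is
what `mincol` finds. For matrices of forests with `a` and `b` nodes, the product takes
`O((a + 1) (b + 1) (|G| + 1))` range operations and queries (`product_isSim`). Only values that are
reached in a row are asked for, so that no query is ever made whose answer is left open.

*Time.* The traversal of `F` is read from right to left with a stack of matrices
(`forestLoop_segment`). A product is charged to the pairs of nodes of `F` that it brings together,
and no pair is brought together twice, whence `O(|F|² |G|)` in total (`forestCost_step`). Since each
range operation or query comes with an elementary step, the bound on the number of elementary steps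
bounds the time (`Exec.ops_le`).
-/

namespace TED

open Relation (ReflTransGen)

variable {α : Type}

/-! ### Edit distance and matchings -/

theorem Forest.append_nil (F : Forest α) : F.append .nil = F := by
  induction F with
  | nil => rfl
  | cons a c r _ ih => simp [Forest.append, ih]

theorem Forest.append_assoc (F G H : Forest α) :
    (F.append G).append H = F.append (G.append H) := by
  induction F with
  | nil => rfl
  | cons a c r _ ih => simp [Forest.append, ih]

/-- `Matching F G s`: there is an order-preserving partial matching of the nodes of `F` with the
nodes of `G` whose weight is at least `s`, where a matched pair weighs `2` if the labels agree, and
`1` otherwise. The matching is built from the left: the leftmost root of one of the forests is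
deleted, or the two leftmost roots are matched. -/
inductive Matching : Forest α → Forest α → ℕ → Prop
  | nil : Matching .nil .nil 0
  | deleteLeft {a : α} {c r G : Forest α} {s : ℕ} (h : Matching (c.append r) G s) :
      Matching (.cons a c r) G s
  | deleteRight {F : Forest α} {b : α} {c r : Forest α} {s : ℕ} (h : Matching F (c.append r) s) :
      Matching F (.cons b c r) s
  | pair {a b : α} {c r c' r' : Forest α} {s t w : ℕ} (hc : Matching c c' s)
      (hr : Matching r r' t) (hw : w ≤ 2) (hab : a ≠ b → w ≤ 1) :
      Matching (.cons a c r) (.cons b c' r') (s + t + w)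

namespace Matching

theorem symm {F G : Forest α} {s : ℕ} (h : Matching F G s) : Matching G F s := by
  induction h with
  | nil => exact .nil
  | deleteLeft _ ih => exact .deleteRight ih
  | deleteRight _ ih => exact .deleteLeft ih
  | pair _ _ hw hab ihc ihr => exact .pair ihc ihr hw fun h => hab h.symm

theorem mono {F G : Forest α} {s s' : ℕ} (h : Matching F G s) (hs : s' ≤ s) :
    Matching F G s' := by
  induction h generalizing s' with
  | nil => obtain rfl := Nat.le_zero.1 hs; exact .nil
  | deleteLeft _ ih => exact .deleteLeft (ih hs)
  | deleteRight _ ih => exact .deleteRight (ih hs)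
  | @pair a b c r c' r' s t w _ _ hw hab ihc ihr =>
    have h := Matching.pair (a := a) (b := b) (ihc (s' := min s s') (by omega))
      (ihr (s' := min t (s' - s)) (by omega)) (w := s' - s - t) (by omega)
      (fun h => by have := hab h; omega)
    convert h using 1
    omega

theorem le_two_mul_size {F G : Forest α} {s : ℕ} (h : Matching F G s) : s ≤ 2 * F.size := by
  induction h with
  | nil => simp
  | deleteLeft _ ih => rw [Forest.size_append] at ih; simp only [Forest.size]; omega
  | deleteRight _ ih => exact ih
  | pair _ _ _ _ ihc ihr => simp only [Forest.size]; omega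

theorem refl (F : Forest α) : Matching F F (2 * F.size) := by
  induction F with
  | nil => exact .nil
  | cons a c r ihc ihr =>
    convert Matching.pair (a := a) (b := a) ihc ihr le_rfl (fun h => absurd rfl h) using 1
    simp only [Forest.size]
    ring

theorem nil_zero (G : Forest α) : Matching .nil G 0 := by
  generalize hn : G.size = n
  induction n using Nat.strong_induction_on generalizing G with
  | _ n ih =>
    cases G with
    | nil => exact .nil
    | cons b c r =>
      refine .deleteRight (ih _ ?_ _ rfl)
      rw [Forest.size_append, ← hn]
      simp [Forest.size]

end Matching

theorem EditStep.cases_eq {F H : Forest α} (h : EditStep F H) :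
    (∃ a c r, F = .cons a c r ∧ H = c.append r) ∨
    (∃ a b c r, F = .cons a c r ∧ H = .cons b c r) ∨
    (∃ a c c' r, EditStep c c' ∧ F = .cons a c r ∧ H = .cons a c' r) ∨
    (∃ a c r r', EditStep r r' ∧ F = .cons a c r ∧ H = .cons a c r') := by
  cases h with
  | relabel a b c r _ => exact .inr (.inl ⟨a, b, c, r, rfl, rfl⟩)
  | delete a c r => exact .inl ⟨a, c, r, rfl, rfl⟩
  | child a c c' r h => exact .inr (.inr (.inl ⟨a, c, c', r, h, rfl, rfl⟩))
  | sibling a c r r' h => exact .inr (.inr (.inr ⟨a, c, r, r', h, rfl, rfl⟩))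

theorem EditStep.size_le {F H : Forest α} (h : EditStep F H) :
    H.size ≤ F.size ∧ F.size ≤ H.size + 1 := by
  induction h with
  | relabel => simp [Forest.size]
  | delete a c r => rw [Forest.size_append]; simp [Forest.size]
  | child a c c' r _ ih => simp only [Forest.size]; omega
  | sibling a c r r' _ ih => simp only [Forest.size]; omega

theorem EditStep.append_right {F H : Forest α} (h : EditStep F H) (Z : Forest α) :
    EditStep (F.append Z) (H.append Z) := by
  induction h with
  | relabel a b c r h => exact .relabel a b c _ h
  | delete a c r => rw [Forest.append_assoc]; exact .delete a c _
  | child a c c' r h _ => exact .child a c c' _ h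
  | sibling a c r r' _ ih => exact .sibling a c _ _ ih

theorem EditStep.append_left {F H : Forest α} (h : EditStep F H) (Z : Forest α) :
    EditStep (Z.append F) (Z.append H) := by
  induction Z with
  | nil => exact h
  | cons a c r _ ih => exact .sibling a c _ _ ih

/-- The number of nodes of a forest minus the weight of its best matching with `G` drops by at most
one when an edit operation is applied to the forest. -/
theorem Matching.of_editStep {H G : Forest α} {s : ℕ} (hm : Matching H G s) {F : Forest α}
    (h : EditStep F H) : Matching F G (s + F.size - H.size - 1) := by
  induction hm generalizing F with
  | nil =>
    have hs := h.size_le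
    obtain ⟨a, c, r, rfl, e⟩ | ⟨a, b, c, r, rfl, e⟩ | ⟨a, c, c', r, h₀, rfl, e⟩ |
      ⟨a, c, r, r', h₀, rfl, e⟩ := h.cases_eq
    · have h0 : Matching (.cons a c r) .nil 0 := .deleteLeft (e ▸ .nil)
      exact h0.mono (by simp only [Forest.size] at hs ⊢; omega)
    all_goals simp at e
  | @deleteLeft b d q G s hm ih =>
    obtain ⟨a, c, r, rfl, e⟩ | ⟨a, b', c, r, rfl, e⟩ | ⟨a, c, c', r, h₀, rfl, e⟩ |
      ⟨a, c, r, r', h₀, rfl, e⟩ := h.cases_eq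
    · rw [e, Forest.size_append]
      exact .deleteLeft (e ▸ (Matching.deleteLeft hm).mono (by simp only [Forest.size]; omega))
    all_goals
      simp only [Forest.cons.injEq] at e
      obtain ⟨rfl, rfl, rfl⟩ := e
    · exact .deleteLeft (hm.mono (by simp only [Forest.size]; omega))
    · refine .deleteLeft ((ih (h₀.append_right _)).mono ?_)
      simp only [Forest.size, Forest.size_append]; omega
    · refine .deleteLeft ((ih (h₀.append_left _)).mono ?_)
      simp only [Forest.size, Forest.size_append]; omega
  | deleteRight _ ih => exact .deleteRight (ih h)
  | @pair b b' d q d' q' s t w hc hr hw hab ihc ihr =>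
    obtain ⟨a, c, r, rfl, e⟩ | ⟨a, b'', c, r, rfl, e⟩ | ⟨a, c, c', r, h₀, rfl, e⟩ |
      ⟨a, c, r, r', h₀, rfl, e⟩ := h.cases_eq
    · rw [e, Forest.size_append]
      exact .deleteLeft (e ▸ (Matching.pair hc hr hw hab).mono
        (by simp only [Forest.size]; omega))
    all_goals
      simp only [Forest.cons.injEq] at e
      obtain ⟨rfl, rfl, rfl⟩ := e
    · refine (Matching.pair hc hr (w := w - 1) (by omega) (fun _ => by omega)).mono ?_
      simp only [Forest.size]; omega
    · refine (Matching.pair (ihc h₀) hr hw hab).mono ?_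
      have := h₀.size_le
      simp only [Forest.size]; omega
    · refine (Matching.pair hc (ihr h₀) hw hab).mono ?_
      have := h₀.size_le
      simp only [Forest.size]; omega

theorem EditSteps.size_le {k : ℕ} {F H : Forest α} (h : EditSteps k F H) :
    H.size ≤ F.size ∧ F.size ≤ H.size + k := by
  induction h with
  | refl => simp
  | step h _ ih => have := h.size_le; omega

theorem Matching.of_editSteps {k : ℕ} {F H G : Forest α} {s : ℕ} (h : EditSteps k F H)
    (hm : Matching H G s) : Matching F G (s + F.size - H.size - k) := by
  induction h with
  | refl => exact hm.mono (by omega)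
  | step h hs ih =>
    have := h.size_le
    have := hs.size_le
    exact ((ih hm).of_editStep h).mono (by omega)

theorem EditSteps.cons_congr {k l : ℕ} {c c' r r' : Forest α} (a : α) (h : EditSteps k c c')
    (h' : EditSteps l r r') : EditSteps (k + l) (.cons a c r) (.cons a c' r') := by
  induction h with
  | refl =>
    rw [zero_add]
    induction h' with
    | refl => exact .refl _
    | step h _ ih => exact .step (.sibling _ _ _ _ h) ih
  | @step k _ _ _ h _ ih =>
    rw [show k + 1 + l = k + l + 1 by omega]
    exact .step (.child _ _ _ _ h) ih

theorem Matching.exists_editSteps {F G : Forest α} {s : ℕ} (h : Matching F G s) :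
    ∃ i j H, EditSteps i F H ∧ EditSteps j G H ∧ i + j + s ≤ F.size + G.size := by
  induction h with
  | nil => exact ⟨0, 0, .nil, .refl _, .refl _, by simp⟩
  | @deleteLeft a c r G s _ ih =>
    obtain ⟨i, j, H, h₁, h₂, h⟩ := ih
    refine ⟨i + 1, j, H, .step (.delete _ _ _) h₁, h₂, ?_⟩
    rw [Forest.size_append] at h
    simp only [Forest.size]; omega
  | @deleteRight F b c r s _ ih =>
    obtain ⟨i, j, H, h₁, h₂, h⟩ := ih
    refine ⟨i, j + 1, H, h₁, .step (.delete _ _ _) h₂, ?_⟩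
    rw [Forest.size_append] at h
    simp only [Forest.size]; omega
  | @pair a b c r c' r' s t w _ _ hw hab ihc ihr =>
    obtain ⟨i, j, H, h₁, h₂, h⟩ := ihc
    obtain ⟨i', j', H', h₁', h₂', h'⟩ := ihr
    by_cases e : a = b
    · subst e
      refine ⟨i + i', j + j', .cons a H H', h₁.cons_congr a h₁', h₂.cons_congr a h₂', ?_⟩
      simp only [Forest.size]; omega
    · refine ⟨i + i' + 1, j + j', .cons b H H', .step (.relabel a b c r e) (h₁.cons_congr b h₁'),
        h₂.cons_congr b h₂', ?_⟩
      have := hab e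
      simp only [Forest.size]; omega

/-- The similarity is the largest weight of a matching. -/
theorem matching_iff_le_sim {F G : Forest α} {s : ℕ} : Matching F G s ↔ s ≤ sim F G := by
  constructor
  · intro h
    obtain ⟨i, j, H, h₁, h₂, h⟩ := h.exists_editSteps
    have : ed F G ≤ i + j := Nat.sInf_le ⟨i, j, H, rfl, h₁, h₂⟩
    rw [sim]; omega
  · intro h
    obtain ⟨i, j, H, hk, h₁, h₂⟩ :
        ed F G ∈ {k | ∃ (i j : ℕ) (H : Forest α), i + j = k ∧ EditSteps i F H ∧
          EditSteps j G H} :=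
      Nat.sInf_mem ⟨_, F.size, G.size, .nil, rfl, editSteps_nil _ F rfl, editSteps_nil _ G rfl⟩
    have hm := Matching.of_editSteps h₂ ((Matching.refl H).of_editSteps h₁).symm
    refine hm.symm.mono ?_
    have := h₁.size_le
    have := h₂.size_le
    rw [sim, ← hk] at h
    omega

/-! ### Deletions -/

/-- `G` results from `F` by removing nodes. -/
def Deletes : Forest α → Forest α → Prop :=
  ReflTransGen fun F G => EditStep F G ∧ F.size = G.size + 1

theorem Deletes.refl (F : Forest α) : Deletes F F := ReflTransGen.refl

theorem Deletes.trans {F G H : Forest α} (h : Deletes F G) (h' : Deletes G H) : Deletes F H :=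
  ReflTransGen.trans h h'

theorem Deletes.append {F F' G G' : Forest α} (h : Deletes F F') (h' : Deletes G G') :
    Deletes (F.append G) (F'.append G') := by
  have h₁ : Deletes (F.append G) (F'.append G) := by
    induction h with
    | refl => exact .refl _
    | tail _ hs ih =>
      exact ih.tail ⟨hs.1.append_right G, by have := hs.2; simp only [Forest.size_append]; omega⟩
  refine h₁.trans ?_
  induction h' with
  | refl => exact .refl _
  | tail _ hs ih =>
    exact ih.tail ⟨hs.1.append_left F', by have := hs.2; simp only [Forest.size_append]; omega⟩

theorem Deletes.cons {c c' r r' : Forest α} (a : α) (h : Deletes c c') (h' : Deletes r r') :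
    Deletes (.cons a c r) (.cons a c' r') := by
  have h₁ : Deletes (.cons a c r) (.cons a c' r) := by
    induction h with
    | refl => exact .refl _
    | tail _ hs ih =>
      exact ih.tail ⟨.child a _ _ r hs.1, by have := hs.2; simp only [Forest.size]; omega⟩
  refine h₁.trans ?_
  induction h' with
  | refl => exact .refl _
  | tail _ hs ih =>
    exact ih.tail ⟨.sibling a c' _ _ hs.1, by have := hs.2; simp only [Forest.size]; omega⟩

theorem Deletes.root (a : α) (c r : Forest α) : Deletes (.cons a c r) (c.append r) :=
  ReflTransGen.single ⟨.delete a c r, by rw [Forest.size_append, Forest.size]⟩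

theorem Matching.of_deletes {F G G' : Forest α} {s : ℕ} (h : Deletes G G')
    (hm : Matching F G' s) : Matching F G s := by
  induction h using ReflTransGen.head_induction_on with
  | refl => exact hm
  | head h _ ih => exact ((ih.symm.of_editStep h.1).mono (s' := s) (by omega)).symm

theorem Matching.append {F F' G G' : Forest α} {s t : ℕ} (h : Matching F G s)
    (h' : Matching F' G' t) : Matching (F.append F') (G.append G') (s + t) := by
  induction h with
  | nil => simpa [Forest.append] using h'
  | deleteLeft _ ih => rw [Forest.append_assoc] at ih; exact .deleteLeft ih
  | deleteRight _ ih => rw [Forest.append_assoc] at ih; exact .deleteRight ih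
  | @pair a b c r c' r' s u w hc _ hw hab _ ihr =>
    exact (Matching.pair hc ihr hw hab).mono (by omega)

/-! ### Subforests between two positions of the traversal -/

/-- The nodes of `F` that are entered at time `i` or later and left before time `j`, when the
traversal of `F` starts at time `t`. In contrast to `Forest.sub` this is defined by recursion. -/
def Forest.between (i j : ℕ) : ℕ → Forest α → Forest α
  | _, .nil => .nil
  | t, .cons a c r =>
      if i ≤ t ∧ t + 2 * c.size + 1 < j then
        .cons a (between i j (t + 1) c) (between i j (t + 2 * c.size + 2) r)
      else
        (between i j (t + 1) c).append (between i j (t + 2 * c.size + 2) r)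

/-- `HasNode e f b t F`: some node of `F` has the label `b` and is entered at time `e` and left at
time `f`, when the traversal of `F` starts at time `t`. -/
def Forest.HasNode (e f : ℕ) (b : α) : ℕ → Forest α → Prop
  | _, .nil => False
  | t, .cons a c r => (e = t ∧ f = t + 2 * c.size + 1 ∧ b = a) ∨ HasNode e f b (t + 1) c ∨
      HasNode e f b (t + 2 * c.size + 2) r

namespace Forest

theorem HasNode.bounds {e f : ℕ} {b : α} {t : ℕ} {F : Forest α} (h : F.HasNode e f b t) :
    t ≤ e ∧ e < f ∧ f < t + 2 * F.size := by
  induction F generalizing t with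
  | nil => exact h.elim
  | cons a c r ihc ihr =>
    simp only [size]
    rcases h with h | h | h
    · omega
    · have := ihc h; omega
    · have := ihr h; omega

theorem between_of_le {i j t : ℕ} {F : Forest α} (h : j ≤ t + 1) : F.between i j t = .nil := by
  induction F generalizing t with
  | nil => rfl
  | cons a c r ihc ihr =>
    rw [between, if_neg (by omega), ihc (by omega), ihr (by omega), append]

theorem between_of_ge {i j t : ℕ} {F : Forest α} (h : t + 2 * F.size ≤ i) :
    F.between i j t = .nil := by
  induction F generalizing t with
  | nil => rfl
  | cons a c r ihc ihr =>
    simp only [size] at h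
    rw [between, if_neg (by omega), ihc (by omega), ihr (by omega), append]

theorem between_congr_left {i i' j t : ℕ} {F : Forest α} (h : i ≤ t) (h' : i' ≤ t) :
    F.between i j t = F.between i' j t := by
  induction F generalizing t with
  | nil => rfl
  | cons a c r ihc ihr =>
    simp only [between, h, h', true_and]
    rw [ihc (by omega) (by omega), ihr (by omega) (by omega)]

theorem between_congr_right {i j j' t : ℕ} {F : Forest α} (h : t + 2 * F.size ≤ j)
    (h' : t + 2 * F.size ≤ j') : F.between i j t = F.between i j' t := by
  induction F generalizing t with
  | nil => rfl
  | cons a c r ihc ihr =>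
    simp only [size] at h h'
    have h₁ : t + 2 * c.size + 1 < j := by omega
    have h₂ : t + 2 * c.size + 1 < j' := by omega
    simp only [between, h₁, h₂]
    rw [ihc (by omega) (by omega), ihr (by omega) (by omega)]

theorem between_eq_self {i j t : ℕ} {F : Forest α} (h : i ≤ t) (h' : t + 2 * F.size ≤ j) :
    F.between i j t = F := by
  induction F generalizing t with
  | nil => rfl
  | cons a c r ihc ihr =>
    simp only [size] at h'
    rw [between, if_pos (by omega), ihc (by omega) (by omega), ihr (by omega) (by omega)]

/-- A non-empty subforest between two positions consists of its leftmost root, what lies below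
that root, and what lies to the right of it; these parts lie between positions as well. -/
theorem between_eq_nil_or_cons (i j t : ℕ) (F : Forest α) :
    F.between i j t = .nil ∨ ∃ e f b, F.HasNode e f b t ∧ i ≤ e ∧ e < f ∧ f < j ∧
      F.between i j t = .cons b (F.between (e + 1) f t) (F.between (f + 1) j t) ∧
      F.between (e + 1) j t = (F.between (e + 1) f t).append (F.between (f + 1) j t) := by
  induction F generalizing t with
  | nil => exact .inl rfl
  | cons a c r ihc ihr =>
    by_cases hk : i ≤ t ∧ t + 2 * c.size + 1 < j
    · refine .inr ⟨t, t + 2 * c.size + 1, a, .inl ⟨rfl, rfl, rfl⟩, hk.1, by omega, hk.2, ?_⟩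
      have h₁ : (cons a c r).between (t + 1) (t + 2 * c.size + 1) t = c := by
        rw [between, if_neg (by omega), between_eq_self (by omega) (by omega),
          between_of_le (by omega), append_nil]
      have h₂ : (cons a c r).between (t + 2 * c.size + 1 + 1) j t =
          r.between i j (t + 2 * c.size + 2) := by
        rw [between, if_neg (by omega), between_of_ge (by omega), append]
        exact between_congr_left (by omega) (by omega)
      rw [h₁, h₂, between, if_pos hk, between_eq_self (F := c) (by omega) (by omega), between,
        if_neg (by omega), between_eq_self (F := c) (by omega) (by omega)]
      exact ⟨rfl, congrArg _ (between_congr_left (by omega) (by omega))⟩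
    · rw [between, if_neg hk]
      rcases ihc (t + 1) with hc | ⟨e, f, b, hn, h₁, h₂, h₃, h₄, h₅⟩
      · rw [hc, append]
        rcases ihr (t + 2 * c.size + 2) with hr | ⟨e, f, b, hn, h₁, h₂, h₃, h₄, h₅⟩
        · exact .inl hr
        · have hb := hn.bounds
          refine .inr ⟨e, f, b, .inr (.inr hn), h₁, h₂, h₃, ?_⟩
          have hz : ∀ x y, t + 2 * c.size + 2 ≤ x →
              (cons a c r).between x y t = r.between x y (t + 2 * c.size + 2) := by
            intro x y hx
            rw [between, if_neg (by omega), between_of_ge (by omega), append]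
          rw [hz _ _ (by omega), hz _ _ (by omega), hz _ _ (by omega)]
          exact ⟨h₄, h₅⟩
      · have hb := hn.bounds
        refine .inr ⟨e, f, b, .inr (.inl hn), h₁, h₂, h₃, ?_⟩
        have hz : ∀ x, i ≤ x → t + 1 ≤ x → x ≤ t + 2 * c.size + 2 →
            (cons a c r).between x j t =
              (c.between x j (t + 1)).append (r.between i j (t + 2 * c.size + 2)) := by
          intro x hi hx hx'
          rw [between, if_neg (by omega)]
          exact congrArg _ (between_congr_left (by omega) (by omega))
        have hy : (cons a c r).between (e + 1) f t = c.between (e + 1) f (t + 1) := by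
          rw [between, if_neg (by omega), between_of_le (F := r) (by omega), append_nil]
        rw [hz _ (by omega) (by omega) (by omega), hz _ (by omega) (by omega) (by omega), hy, h₄,
          h₅, append, append_assoc]
        exact ⟨rfl, rfl⟩

theorem HasNode.between_eq {e f : ℕ} {b : α} {t : ℕ} {F : Forest α} (h : F.HasNode e f b t) :
    F.between e (f + 1) t = .cons b (F.between (e + 1) f t) .nil := by
  induction F generalizing t with
  | nil => exact h.elim
  | cons a c r ihc ihr =>
    rcases h with ⟨rfl, rfl, rfl⟩ | h | h
    · rw [between, if_pos (by omega), between_eq_self (by omega) (by omega),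
        between_of_le (F := r) (by omega), between, if_neg (by omega),
        between_eq_self (by omega) (by omega), between_of_le (F := r) (by omega), append_nil]
    · have hb := h.bounds
      rw [between, if_neg (by omega), ihc h, between_of_le (F := r) (by omega), append_nil,
        between, if_neg (by omega), between_of_le (F := r) (by omega), append_nil]
    · have hb := h.bounds
      rw [between, if_neg (by omega), ihr h, between_of_ge (F := c) (by omega), append,
        between, if_neg (by omega), between_of_ge (F := c) (by omega), append]

theorem between_deletes {i j i' j' : ℕ} (hi : i ≤ i') (hj : j' ≤ j) (t : ℕ) (F : Forest α) :
    Deletes (F.between i j t) (F.between i' j' t) := by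
  induction F generalizing t with
  | nil => exact .refl _
  | cons a c r ihc ihr =>
    by_cases h : i' ≤ t ∧ t + 2 * c.size + 1 < j'
    · rw [between, if_pos (by omega), between, if_pos h]
      exact (ihc _).cons a (ihr _)
    · rw [between, between, if_neg h]
      split_ifs
      · exact (Deletes.root _ _ _).trans ((ihc _).append (ihr _))
      · exact (ihc _).append (ihr _)

/-- Cutting at the position `k` removes the nodes that are open at that position. -/
theorem between_deletes_append {i k j : ℕ} (hi : i ≤ k) (hj : k ≤ j) (t : ℕ) (F : Forest α) :
    Deletes (F.between i j t) ((F.between i k t).append (F.between k j t)) := by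
  induction F generalizing t with
  | nil => exact .refl _
  | cons a c r ihc ihr =>
    by_cases h₁ : k ≤ t
    · rw [between_of_le (j := k) (by omega), append,
        between_congr_left (i := k) (i' := i) h₁ (by omega)]
      exact .refl _
    by_cases h₂ : i ≤ t ∧ t + 2 * c.size + 1 < k
    · rw [between, if_pos (by omega), between, if_pos h₂, between, if_neg (by omega),
        between_of_ge (i := k) (F := c) (by omega), append, append]
      refine .cons a ?_ (ihr _)
      rw [between_congr_right (j := j) (j' := k) (by omega) (by omega)]
      exact .refl _
    · have key : Deletes ((c.between i j (t + 1)).append (r.between i j (t + 2 * c.size + 2)))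
          (((cons a c r).between i k t).append ((cons a c r).between k j t)) := by
        rw [between, if_neg h₂, between, if_neg (by omega)]
        refine ((ihc _).append (ihr _)).trans ?_
        by_cases h₃ : k ≤ t + 2 * c.size + 2
        · rw [between_of_le (j := k) (F := r) (by omega)]
          simp only [append_assoc, append]
          exact .refl _
        · rw [between_of_ge (i := k) (F := c) (by omega)]
          simp only [append_assoc, append]
          exact .refl _
      rw [between]
      split_ifs
      · exact (Deletes.root _ _ _).trans key
      · exact key

end Forest

/-! ### Recursions for the similarity -/

theorem Matching.between_mono {A F : Forest α} {i j i' j' t s : ℕ}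
    (h : Matching A (F.between i' j' t) s) (hi : i ≤ i') (hj : j' ≤ j) :
    Matching A (F.between i j t) s :=
  h.of_deletes (F.between_deletes hi hj t)

theorem Matching.between_append {A B F : Forest α} {i k j t s u : ℕ} (hi : i ≤ k) (hj : k ≤ j)
    (h : Matching A (F.between i k t) s) (h' : Matching B (F.between k j t) u) :
    Matching (A.append B) (F.between i j t) (s + u) :=
  (h.append h').of_deletes (F.between_deletes_append hi hj t)

/-- A matching of `A.append B` splits at some position into a matching of `A` and one of `B`. -/
theorem Matching.exists_split {A B F : Forest α} {i j t s : ℕ} (hij : i ≤ j)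
    (h : Matching (A.append B) (F.between i j t) s) :
    ∃ k u v, i ≤ k ∧ k ≤ j ∧ Matching A (F.between i k t) u ∧ Matching B (F.between k j t) v ∧
      s = u + v := by
  generalize hC : A.append B = C at h
  generalize hX : F.between i j t = X at h
  induction h generalizing A i with
  | nil =>
    cases A with
    | nil =>
      refine ⟨i, 0, 0, le_rfl, hij, .nil_zero _, ?_, rfl⟩
      rw [Forest.append] at hC
      rw [hC]
      exact .nil_zero _
    | cons a c r => simp [Forest.append] at hC
  | @deleteLeft a c r X s h ih =>
    cases A with
    | nil =>
      refine ⟨i, 0, s, le_rfl, hij, .nil_zero _, ?_, (zero_add _).symm⟩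
      rw [Forest.append] at hC
      rw [hC, hX]
      exact .deleteLeft h
    | cons a' c' r' =>
      simp only [Forest.append, Forest.cons.injEq] at hC
      obtain ⟨rfl, rfl, rfl⟩ := hC
      obtain ⟨k, u, v, h₁, h₂, h₃, h₄, h₅⟩ := ih hij (Forest.append_assoc _ _ _) hX
      exact ⟨k, u, v, h₁, h₂, .deleteLeft h₃, h₄, h₅⟩
  | @deleteRight C b c r s h ih =>
    rcases F.between_eq_nil_or_cons i j t with h₀ | ⟨e, f, b', hn, h₁, h₂, h₃, h₄, h₅⟩
    · rw [h₀] at hX; cases hX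
    -- Deleting the leftmost root of the subforest moves its left end to the next position.
    · rw [h₄] at hX
      cases hX
      obtain ⟨k, u, v, g₁, g₂, g₃, g₄, g₅⟩ := ih (i := e + 1) (by omega) hC h₅
      exact ⟨k, u, v, by omega, g₂, g₃.between_mono (by omega) le_rfl, g₄, g₅⟩
  | @pair a b c r c' r' s u w hc hr hw hab ihc ihr =>
    cases A with
    | nil =>
      refine ⟨i, 0, _, le_rfl, hij, .nil_zero _, ?_, (zero_add _).symm⟩
      rw [Forest.append] at hC
      rw [hC, hX]
      exact .pair hc hr hw hab
    | cons a' d q =>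
      simp only [Forest.append, Forest.cons.injEq] at hC
      obtain ⟨rfl, rfl, rfl⟩ := hC
      rcases F.between_eq_nil_or_cons i j t with h₀ | ⟨e, f, b', hn, h₁, h₂, h₃, h₄, h₅⟩
      · rw [h₀] at hX; cases hX
      · rw [h₄] at hX
        cases hX
        obtain ⟨k, u, v, g₁, g₂, g₃, g₄, rfl⟩ := ihr (i := f + 1) (by omega) rfl rfl
        refine ⟨k, s + u + w, v, by omega, g₂, ?_, g₄, by omega⟩
        have hm := (Matching.pair hc g₃ hw hab).of_deletes (G := F.between e k t) (by
          have := F.between_deletes_append (i := e) (k := f + 1) (j := k) (by omega) g₁ t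
          rw [hn.between_eq] at this
          exact this)
        exact hm.between_mono h₁ le_rfl

/-- In a matching of a tree, the root is deleted, or it is matched with some node `v`, and its
children are matched below `v`. -/
theorem matching_tree_iff {a : α} {c F : Forest α} {i j t s : ℕ} :
    Matching (.cons a c .nil) (F.between i j t) s ↔ Matching c (F.between i j t) s ∨
      ∃ e f b, F.HasNode e f b t ∧ i ≤ e ∧ f < j ∧ ∃ y w, Matching c (F.between (e + 1) f t) y ∧
        w ≤ 2 ∧ (a ≠ b → w ≤ 1) ∧ s = y + w := by
  constructor
  · intro h
    generalize hC : Forest.cons a c .nil = C at h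
    generalize hX : F.between i j t = X at h
    induction h generalizing i with
    | nil => cases hC
    | deleteLeft h _ =>
      cases hC
      rw [Forest.append_nil] at h
      exact .inl h
    | deleteRight _ ih =>
      rcases F.between_eq_nil_or_cons i j t with h₀ | ⟨e, f, b', hn, h₁, h₂, h₃, h₄, h₅⟩
      · rw [h₀] at hX; cases hX
      · have hX' := hX
        rw [h₄] at hX
        cases hX
        rcases ih hC h₅ with h | ⟨e', f', b, g₁, g₂, g₃, g₄⟩
        · rw [← hX', ← h₅] at *
          exact .inl (h.between_mono (by omega) le_rfl)
        · exact .inr ⟨e', f', b, g₁, by omega, g₃, g₄⟩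
    | @pair a b c r c' r' s u w hc hr hw hab _ _ =>
      cases hC
      rcases F.between_eq_nil_or_cons i j t with h₀ | ⟨e, f, b', hn, h₁, h₂, h₃, h₄, h₅⟩
      · rw [h₀] at hX; cases hX
      · rw [h₄] at hX
        cases hX
        have := hr.le_two_mul_size
        simp only [Forest.size] at this
        exact .inr ⟨e, f, b, hn, h₁, h₃, s, w, hc, hw, hab, by omega⟩
  · rintro (h | ⟨e, f, b, hn, h₁, h₂, y, w, hm, hw, hab, rfl⟩)
    · exact .deleteLeft (by rwa [Forest.append_nil])
    · have := Matching.pair hm .nil hw hab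
      rw [← hn.between_eq] at this
      exact (this.mono (by omega)).between_mono h₁ (by omega)

/-! ### The two descriptions of a subforest agree -/

namespace Forest

theorem biorder_name_bounds {F : Forest α} {t x : ℕ}
    (h : x ∈ (F.name t).biorder.map Prod.fst) : t ≤ x ∧ x < t + 2 * F.size := by
  induction F generalizing t with
  | nil => simp [name, biorder] at h
  | cons a c r ihc ihr =>
    simp only [name, biorder, List.map_cons, List.map_append, List.mem_cons, List.mem_append] at h
    simp only [size]
    rcases h with h | h | h | h
    · omega
    · have := ihc h; omega
    · omega
    · have := ihr h; omega

theorem length_biorder_name (F : Forest α) (t : ℕ) : (F.name t).biorder.length = 2 * F.size := by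
  induction F generalizing t with
  | nil => rfl
  | cons a c r ihc ihr =>
    simp only [name, biorder, List.length_cons, List.length_append, ihc, ihr, size]
    ring

theorem map_append_forest {β : Type} (g : α → β) (F G : Forest α) :
    (F.append G).map g = (F.map g).append (G.map g) := by
  induction F with
  | nil => rfl
  | cons a c r _ ih => simp [append, map, ih]

/-- Non-membership of `x` in the two ends of a list, given the first and the last occurrence of `x`
in that list. -/
theorem notMem_take_and_drop {pre mid post : List ℕ} {x p q : ℕ} (h₁ : x ∉ pre) (h₃ : x ∉ post) :
    (x ∉ (pre ++ x :: (mid ++ x :: post)).take p ↔ p ≤ pre.length) ∧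
    (x ∉ (pre ++ x :: (mid ++ x :: post)).drop q ↔ pre.length + mid.length + 1 < q) := by
  constructor
  · rw [List.take_append, List.mem_append, not_or]
    constructor
    · rintro ⟨-, h⟩
      by_contra hp
      obtain ⟨d, hd⟩ : ∃ d, p - pre.length = d + 1 := ⟨p - pre.length - 1, by omega⟩
      simp [hd] at h
    · intro h
      refine ⟨fun h => h₁ (List.mem_of_mem_take h), ?_⟩
      simp [show p - pre.length = 0 by omega]
  · constructor
    · intro h
      by_contra hq
      refine h (List.mem_iff_getElem.2 ⟨pre.length + mid.length + 1 - q, ?_, ?_⟩)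
      · simp; omega
      · rw [List.getElem_drop]
        simp only [show q + (pre.length + mid.length + 1 - q) = pre.length + mid.length + 1 by
          omega]
        rw [List.getElem_append_right (by omega)]
        simp only [show pre.length + mid.length + 1 - pre.length = mid.length + 1 by omega]
        simp
    · intro h
      rw [show pre ++ x :: (mid ++ x :: post) = (pre ++ x :: (mid ++ [x])) ++ post by simp,
        List.drop_append, List.drop_of_length_le (by simp; omega), List.nil_append]
      exact fun h => h₃ (List.mem_of_mem_drop h)

/-- `L` is the sequence of names of the whole forest, of which `F` is a part whose traversal lies
between `pre` and `post`. -/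
theorem map_keep_name {L pre post : List ℕ} {i j t : ℕ} (F : Forest α) (hi : 1 ≤ i) (hj : 1 ≤ j)
    (hL : L = pre ++ ((F.name t).biorder.map Prod.fst ++ post)) (hpre : pre.length + 1 = t)
    (hp : ∀ x ∈ pre, x < t ∨ t + 2 * F.size ≤ x) (hq : ∀ x ∈ post, x < t ∨ t + 2 * F.size ≤ x) :
    ((F.name t).keep fun u => u.1 ∉ L.take (i - 1) ∧ u.1 ∉ L.drop (j - 1)).map Prod.snd =
      F.between i j t := by
  induction F generalizing t pre post with
  | nil => rfl
  | cons a c r ihc ihr =>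
    simp only [size] at hp hq
    have hroot : (t ∉ L.take (i - 1) ∧ t ∉ L.drop (j - 1)) ↔
        (i ≤ t ∧ t + 2 * c.size + 1 < j) := by
      have := notMem_take_and_drop (pre := pre) (mid := (c.name (t + 1)).biorder.map Prod.fst)
        (post := (r.name (t + 2 * c.size + 2)).biorder.map Prod.fst ++ post)
        (x := t) (p := i - 1) (q := j - 1) (fun h => by have := hp _ h; omega)
        (fun h => by
          rcases List.mem_append.1 h with h | h
          · have := biorder_name_bounds h; omega
          · have := hq _ h; omega)
      rw [List.length_map, length_biorder_name] at this
      have hL' : L = pre ++ t :: ((c.name (t + 1)).biorder.map Prod.fst ++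
          t :: ((r.name (t + 2 * c.size + 2)).biorder.map Prod.fst ++ post)) := by
        rw [hL]; simp [name, biorder]
      rw [hL', this.1, this.2]
      omega
    have hc := ihc (t := t + 1) (pre := pre ++ [t])
      (post := t :: ((r.name (t + 2 * c.size + 2)).biorder.map Prod.fst ++ post))
      (by rw [hL]; simp [name, biorder]) (by simp [hpre])
      (fun x hx => by
        rcases List.mem_append.1 hx with h | h
        · have := hp _ h; omega
        · simp at h; omega)
      (fun x hx => by
        rcases List.mem_cons.1 hx with h | h
        · omega
        · rcases List.mem_append.1 h with h | h
          · have := biorder_name_bounds h; omega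
          · have := hq _ h; omega)
    have hr := ihr (t := t + 2 * c.size + 2)
      (pre := pre ++ t :: ((c.name (t + 1)).biorder.map Prod.fst ++ [t]))
      (post := post)
      (by rw [hL]; simp [name, biorder])
      (by simp [length_biorder_name]; omega)
      (fun x hx => by
        rcases List.mem_append.1 hx with h | h
        · have := hp _ h; omega
        · rcases List.mem_cons.1 h with h | h
          · omega
          · rcases List.mem_append.1 h with h | h
            · have := biorder_name_bounds h; omega
            · simp at h; omega)
      (fun x hx => by have := hq _ hx; omega)
    rw [name, keep, between]
    by_cases h : i ≤ t ∧ t + 2 * c.size + 1 < j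
    · rw [if_pos (hroot.2 h), if_pos h, map, hc, hr]
    · rw [if_neg (mt hroot.1 h), if_neg h, map_append_forest, hc, hr]

theorem sub_eq_between (F : Forest α) {i j : ℕ} (hi : 1 ≤ i) (hj : 1 ≤ j) :
    F.sub i j = F.between i j 1 :=
  map_keep_name (pre := []) (post := []) F hi hj (by simp) rfl (by simp) (by simp)

end Forest

/-! ### Range operations and range queries -/

theorem natCast_le_decode {v x : ℕ} : (x : WithBot ℕ) ≤ decode v ↔ x < v := by
  cases v with
  | zero => simp [decode]
  | succ n => rw [decode, Nat.cast_withBot, Nat.cast_withBot, WithBot.coe_le_coe]; omega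

theorem lt_encode_iff {a : WithBot ℕ} {x : ℕ} : x < encode a ↔ (x : WithBot ℕ) ≤ a := by
  cases a with
  | bot => simp [encode]
  | coe n =>
    rw [Nat.cast_withBot, WithBot.coe_le_coe]
    change x < n + 1 ↔ x ≤ n
    omega

@[simp]
theorem decode_succ (n : ℕ) : decode (n + 1) = (n : WithBot ℕ) := rfl

theorem withBot_ext {a b : WithBot ℕ} (h : ∀ x : ℕ, (x : WithBot ℕ) ≤ a ↔ (x : WithBot ℕ) ≤ b) :
    a = b := by
  refine eq_of_forall_le_iff fun c => ?_
  cases c with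
  | bot => simp
  | coe n => exact h n

namespace Mat

theorem natCast_le_rangemax {A : Mat} {i' j' v i j x : ℕ} :
    (x : WithBot ℕ) ≤ (A.rangemax i' j' (decode v)).entry i j ↔
      (x : WithBot ℕ) ≤ A.entry i j ∨ (i ≤ i' ∧ j' ≤ j ∧ x < v) := by
  rw [rangemax]
  dsimp only
  split_ifs with h
  · rw [le_max_iff, natCast_le_decode]; tauto
  · tauto

@[simp]
theorem rows_rangemax (A : Mat) (i j : ℕ) (x : WithBot ℕ) : (A.rangemax i j x).rows = A.rows := rfl

@[simp]
theorem cols_rangemax (A : Mat) (i j : ℕ) (x : WithBot ℕ) : (A.rangemax i j x).cols = A.cols := rfl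

/-- The query `mincol`, where its answer is determined. -/
theorem mincol_spec {A : Mat} {d i j : ℕ} {x : WithBot ℕ} (hj : 1 ≤ j) (hj' : j ≤ A.cols)
    (hx : x ≤ A.entry i j) :
    1 ≤ A.mincol d i x ∧ A.mincol d i x ≤ j ∧ x ≤ A.entry i (A.mincol d i x) := by
  have hm : j ∈ (Finset.Icc 1 A.cols).filter fun j => x ≤ A.entry i j := by simp [*]
  rw [mincol, dif_pos ⟨j, hm⟩]
  have h := Finset.min'_mem _ ⟨j, hm⟩
  simp only [Finset.mem_filter, Finset.mem_Icc] at h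
  exact ⟨h.1.1, Finset.min'_le _ _ hm, h.2⟩

/-- The entries decrease in the row number, and increase in the column number. -/
def Monotone (A : Mat) : Prop :=
  ∀ i i' j j', A.InRange i j → A.InRange i' j' → i' ≤ i → j ≤ j' → A.entry i j ≤ A.entry i' j'

end Mat

/-! ### Weakest preconditions -/

/-- The program `p`, started in the state `s`, halts in a state that satisfies `R`. -/
def WP (W : ℕ) (adv : ℕ → ℕ) (p : Cmd) (s : State) (R : State → Prop) : Prop :=
  ∃ t, Exec W adv p s t ∧ R t

attribute [simp] Expr.eval Expr.cost Expr.Fits State.tick State.tickOp State.setVar State.setArr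
  State.setMat Mat.InRange

namespace WP

variable {W : ℕ} {adv : ℕ → ℕ} {s : State} {R R' : State → Prop}

theorem imp {p : Cmd} (h : WP W adv p s R) (hR : ∀ t, R t → R' t) : WP W adv p s R' :=
  let ⟨t, ht, hr⟩ := h
  ⟨t, ht, hR t hr⟩

@[simp]
theorem assign {x : ℕ} {e : Expr} : WP W adv (.assign x e) s R ↔
    e.Fits W s ∧ R ((s.setVar x (e.eval s)).tick (e.cost + 1)) :=
  ⟨fun ⟨_, h, hr⟩ => by cases h with | assign he => exact ⟨he, hr⟩,
    fun ⟨he, hr⟩ => ⟨_, .assign he, hr⟩⟩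

@[simp]
theorem store {a : ℕ} {i e : Expr} : WP W adv (.store a i e) s R ↔ i.Fits W s ∧ e.Fits W s ∧
    R ((s.setArr a (i.eval s) (e.eval s)).tick (i.cost + e.cost + 1)) :=
  ⟨fun ⟨_, h, hr⟩ => by cases h with | store hi he => exact ⟨hi, he, hr⟩,
    fun ⟨hi, he, hr⟩ => ⟨_, .store hi he, hr⟩⟩

@[simp]
theorem newMat {h n m : Expr} : WP W adv (.newMat h n m) s R ↔
    h.Fits W s ∧ n.Fits W s ∧ m.Fits W s ∧
    R ((s.setMat (h.eval s) (Mat.bot (n.eval s) (m.eval s))).tickOp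
      (h.cost + n.cost + m.cost + 1)) :=
  ⟨fun ⟨_, h, hr⟩ => by cases h with | newMat h₁ h₂ h₃ => exact ⟨h₁, h₂, h₃, hr⟩,
    fun ⟨h₁, h₂, h₃, hr⟩ => ⟨_, .newMat h₁ h₂ h₃, hr⟩⟩

@[simp]
theorem copyMat {h g : Expr} : WP W adv (.copyMat h g) s R ↔ h.Fits W s ∧ g.Fits W s ∧
    R ((s.setMat (h.eval s) (s.mat (g.eval s))).tickOp (h.cost + g.cost + 1)) :=
  ⟨fun ⟨_, h, hr⟩ => by cases h with | copyMat h₁ h₂ => exact ⟨h₁, h₂, hr⟩,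
    fun ⟨h₁, h₂, hr⟩ => ⟨_, .copyMat h₁ h₂, hr⟩⟩

@[simp]
theorem rangemax {h g i j x : Expr} : WP W adv (.rangemax h g i j x) s R ↔
    h.Fits W s ∧ g.Fits W s ∧ i.Fits W s ∧ j.Fits W s ∧ x.Fits W s ∧
    (s.mat (g.eval s)).InRange (i.eval s) (j.eval s) ∧
    R ((s.setMat (h.eval s)
      ((s.mat (g.eval s)).rangemax (i.eval s) (j.eval s) (decode (x.eval s)))).tickOp
      (h.cost + g.cost + i.cost + j.cost + x.cost + 1)) :=
  ⟨fun ⟨_, h, hr⟩ => by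
      cases h with | rangemax h₁ h₂ h₃ h₄ h₅ h₆ => exact ⟨h₁, h₂, h₃, h₄, h₅, h₆, hr⟩,
    fun ⟨h₁, h₂, h₃, h₄, h₅, h₆, hr⟩ => ⟨_, .rangemax h₁ h₂ h₃ h₄ h₅ h₆, hr⟩⟩

@[simp]
theorem entry {y : ℕ} {g i j : Expr} : WP W adv (.entry y g i j) s R ↔
    g.Fits W s ∧ i.Fits W s ∧ j.Fits W s ∧
    (s.mat (g.eval s)).InRange (i.eval s) (j.eval s) ∧
    R ((s.setVar y (encode ((s.mat (g.eval s)).entry (i.eval s) (j.eval s)))).tickOp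
      (g.cost + i.cost + j.cost + 1)) :=
  ⟨fun ⟨_, h, hr⟩ => by cases h with | entry h₁ h₂ h₃ h₄ => exact ⟨h₁, h₂, h₃, h₄, hr⟩,
    fun ⟨h₁, h₂, h₃, h₄, hr⟩ => ⟨_, .entry h₁ h₂ h₃ h₄, hr⟩⟩

@[simp]
theorem mincol {y : ℕ} {g i x : Expr} : WP W adv (.mincol y g i x) s R ↔
    g.Fits W s ∧ i.Fits W s ∧ x.Fits W s ∧ (s.mat (g.eval s)).InRange (i.eval s) 1 ∧
    R ((s.setVar y
      ((s.mat (g.eval s)).mincol (adv s.ops) (i.eval s) (decode (x.eval s)))).tickOp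
      (g.cost + i.cost + x.cost + 1)) :=
  ⟨fun ⟨_, h, hr⟩ => by cases h with | mincol h₁ h₂ h₃ h₄ => exact ⟨h₁, h₂, h₃, h₄, hr⟩,
    fun ⟨h₁, h₂, h₃, h₄, hr⟩ => ⟨_, .mincol h₁ h₂ h₃ h₄, hr⟩⟩

@[simp]
theorem seq {p q : Cmd} : WP W adv (.seq p q) s R ↔ WP W adv p s fun t => WP W adv q t R :=
  ⟨fun ⟨_, h, hr⟩ => by cases h with | seq hp hq => exact ⟨_, hp, _, hq, hr⟩,
    fun ⟨_, hp, _, hq, hr⟩ => ⟨_, .seq hp hq, hr⟩⟩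

@[simp]
theorem cond {e : Expr} {p q : Cmd} : WP W adv (.cond e p q) s R ↔ e.Fits W s ∧
    if e.eval s = 0 then WP W adv q (s.tick (e.cost + 1)) R
    else WP W adv p (s.tick (e.cost + 1)) R := by
  constructor
  · rintro ⟨_, h, hr⟩
    cases h with
    | condTrue he h hp => exact ⟨he, by rw [if_neg h]; exact ⟨_, hp, hr⟩⟩
    | condFalse he h hq => exact ⟨he, by rw [if_pos h]; exact ⟨_, hq, hr⟩⟩
  · rintro ⟨he, h⟩
    split_ifs at h with h₀
    · obtain ⟨t, hq, hr⟩ := h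
      exact ⟨t, .condFalse he h₀ hq, hr⟩
    · obtain ⟨t, hp, hr⟩ := h
      exact ⟨t, .condTrue he h₀ hp, hr⟩

theorem loop_done {e : Expr} {p : Cmd} (he : e.Fits W s) (h : e.eval s = 0)
    (hr : R (s.tick (e.cost + 1))) : WP W adv (.loop e p) s R :=
  ⟨_, .loopFalse he h, hr⟩

theorem loop_step {e : Expr} {p : Cmd} (he : e.Fits W s) (h : e.eval s ≠ 0)
    (hp : WP W adv p (s.tick (e.cost + 1)) fun t => WP W adv (.loop e p) t R) :
    WP W adv (.loop e p) s R :=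
  let ⟨_, h₁, _, h₂, hr⟩ := hp
  ⟨_, .loopTrue he h h₁ h₂, hr⟩

/-- A loop that counts the variable `v` down to `0`, with the invariant `I`. -/
theorem countdown {v : ℕ} {p : Cmd} (I : ℕ → State → Prop)
    (h₀ : ∀ t, I 0 t → t.var v = 0 ∧ R (t.tick 2))
    (h₁ : ∀ k t, I (k + 1) t → t.var v = k + 1 ∧ k + 1 ≤ W ∧ WP W adv p (t.tick 2) (I k))
    (k : ℕ) (h : I k s) : WP W adv (.loop (.var v) p) s R := by
  induction k generalizing s with
  | zero =>
    obtain ⟨hv, hr⟩ := h₀ s h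
    exact loop_done (by simp [Expr.Fits, hv]) hv hr
  | succ k ih =>
    obtain ⟨hv, hW, hp⟩ := h₁ k s h
    exact loop_step (by simp [Expr.Fits, hv, hW]) (by simp [Expr.eval, hv])
      (hp.imp fun t ht => ih ht)

end WP

/-- Every range operation or range query comes with an elementary step, so that a bound on the
number of elementary steps bounds the time. -/
theorem Exec.ops_le {W : ℕ} {adv : ℕ → ℕ} {p : Cmd} {s t : State} (h : Exec W adv p s t) :
    t.ops + s.steps ≤ t.steps + s.ops := by
  induction h <;>
    (try simp only [State.tick, State.tickOp, State.setVar, State.setArr, State.setMat] at *) <;>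
    omega

/-- `t` agrees with `s` in the variables below `V`, in the two input arrays, and in the matrix cells
below `D`. -/
structure Preserves (V D : ℕ) (s t : State) : Prop where
  var : ∀ x < V, t.var x = s.var x
  arr : ∀ a < 2, t.arr a = s.arr a
  mat : ∀ h < D, t.mat h = s.mat h

theorem Preserves.refl (V D : ℕ) (s : State) : Preserves V D s s :=
  ⟨fun _ _ => rfl, fun _ _ => rfl, fun _ _ => rfl⟩

theorem Preserves.trans {V D V' D' : ℕ} {s t u : State} (h : Preserves V D s t)
    (h' : Preserves V' D' t u) (hV : V ≤ V') (hD : D ≤ D') : Preserves V D s u :=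
  ⟨fun x hx => (h'.var x (by omega)).trans (h.var x hx),
    fun a ha => (h'.arr a ha).trans (h.arr a ha),
    fun g hg => (h'.mat g (by omega)).trans (h.mat g hg)⟩

theorem Preserves.of {V D : ℕ} {s t u : State} (h : Preserves V D s t)
    (hv : ∀ x < V, u.var x = t.var x) (ha : ∀ a < 2, u.arr a = t.arr a)
    (hm : ∀ g < D, u.mat g = t.mat g) : Preserves V D s u :=
  h.trans ⟨hv, ha, hm⟩ le_rfl le_rfl

variable {W : ℕ} {adv : ℕ → ℕ}

/-! ### Products of matrices -/

/-- For a row `k` of `R`, and for all values `y` that occur in it, in decreasing order: record in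
the result that the rows up to `i` have values of at least `x + y` from the first column on where `R`
reaches `y`. Variable `3` holds the number of the cell of `L`; `R` is in the cell before, and the
result in the cell after it. Variables `6`, `7`, `8`, `9`, and `10` hold `i`, the code of `x`, `k`,
the code of `y`, and the column. -/
def rowLoop : Cmd :=
  .loop (.var 9) <|
    .seq (.mincol 10 (.sub (.var 3) (.const 1)) (.var 8) (.var 9)) <|
    .seq (.rangemax (.add (.var 3) (.const 1)) (.add (.var 3) (.const 1)) (.var 6) (.var 10)
      (.sub (.add (.var 7) (.var 9)) (.const 1)))
    (.assign 9 (.sub (.var 9) (.const 1)))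

theorem rowLoop_spec {s : State} {d m i cx k : ℕ} (h3 : s.var 3 = d + 1)
    (h6 : s.var 6 = i) (h7 : s.var 7 = cx) (h8 : s.var 8 = k)
    (hR : Mat.Monotone (s.mat d)) (hRr : (s.mat d).rows = m) (hRc : (s.mat d).cols = m)
    (hAr : (s.mat (d + 2)).rows = m) (hAc : (s.mat (d + 2)).cols = m)
    (hk : 1 ≤ k ∧ k ≤ m) (hi : 1 ≤ i ∧ i ≤ m) (hcx : 1 ≤ cx)
    (h9 : s.var 9 = encode ((s.mat d).entry k m))
    (hW : d + 2 ≤ W ∧ m ≤ W ∧ cx + s.var 9 ≤ W) :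
    WP W adv rowLoop s fun t => Preserves 9 (d + 2) s t ∧
      (t.mat (d + 2)).rows = m ∧ (t.mat (d + 2)).cols = m ∧
      (∀ i' j', 1 ≤ i' → i' ≤ m → 1 ≤ j' → j' ≤ m → ∀ z : ℕ,
        (z : WithBot ℕ) ≤ (t.mat (d + 2)).entry i' j' ↔
          (z : WithBot ℕ) ≤ (s.mat (d + 2)).entry i' j' ∨
          (i' ≤ i ∧ ∃ y : ℕ, (y : WithBot ℕ) ≤ (s.mat d).entry k j' ∧ z < cx + y)) ∧
      t.steps ≤ s.steps + 2 + 26 * s.var 9 := by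
  -- The values `c ≤ y` have been treated when the counter is `c`.
  refine WP.countdown (fun c t => t.var 9 = c ∧ c ≤ s.var 9 ∧ Preserves 9 (d + 2) s t ∧
      (t.mat (d + 2)).rows = m ∧ (t.mat (d + 2)).cols = m ∧
      (∀ i' j', 1 ≤ i' → i' ≤ m → 1 ≤ j' → j' ≤ m → ∀ z : ℕ,
        (z : WithBot ℕ) ≤ (t.mat (d + 2)).entry i' j' ↔
          (z : WithBot ℕ) ≤ (s.mat (d + 2)).entry i' j' ∨
          (i' ≤ i ∧ ∃ y : ℕ, c ≤ y ∧ (y : WithBot ℕ) ≤ (s.mat d).entry k j' ∧ z < cx + y)) ∧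
      t.steps + 26 * c ≤ s.steps + 26 * s.var 9) ?_ ?_ (s.var 9) ?_
  · rintro t ⟨hv, -, hp, hr, hc, hm, hs⟩
    refine ⟨hv, ⟨hp.var, hp.arr, hp.mat⟩, hr, hc, ?_, ?_⟩
    · simpa using hm
    · simp; omega
  · rintro c t ⟨hv, hle, hp, hr, hc, hm, hs⟩
    refine ⟨hv, by omega, ?_⟩
    have t3 : t.var 3 = d + 1 := by rw [hp.var 3 (by omega), h3]
    have t6 : t.var 6 = i := by rw [hp.var 6 (by omega), h6]
    have t7 : t.var 7 = cx := by rw [hp.var 7 (by omega), h7]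
    have t8 : t.var 8 = k := by rw [hp.var 8 (by omega), h8]
    have tR : t.mat d = s.mat d := hp.mat d (by omega)
    have hex : (c : WithBot ℕ) ≤ (s.mat d).entry k m := lt_encode_iff.1 (by omega)
    have hj := Mat.mincol_spec (A := s.mat d) (d := adv t.ops) (i := k) (j := m) (x := c)
      (by omega) (by omega) hex
    have hj' : ∀ j', 1 ≤ j' → j' ≤ m → (c : WithBot ℕ) ≤ (s.mat d).entry k j' →
        (s.mat d).mincol (adv t.ops) k c ≤ j' := fun j' h₁ h₂ h₃ =>
      (Mat.mincol_spec (d := adv t.ops) h₁ (by omega) h₃).2.1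
    simp [Function.update_apply, Nat.add_assoc, t3, t6, t7, t8, tR, hv]
    generalize (s.mat d).mincol (adv t.ops) k c = j at *
    and_intros
    any_goals omega
    · refine hp.of (fun x hx => ?_) (fun _ _ => rfl) (fun g hg => ?_) <;>
        simp (disch := omega) only [Function.update_of_ne]
    · intro i' j' h₁ h₂ h₃ h₄ z
      rw [Mat.natCast_le_rangemax, hm i' j' h₁ h₂ h₃ h₄]
      constructor
      · rintro ((h | ⟨h, y, hy, hz⟩) | ⟨h, hle, hz⟩)
        · exact .inl h
        · exact .inr ⟨h, y, by omega, hz⟩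
        · exact .inr ⟨h, c, le_rfl, hj.2.2.trans (hR _ _ _ _
            ⟨by omega, by omega⟩ ⟨by omega, by omega⟩ le_rfl hle), hz⟩
      · rintro (h | ⟨h, y, hy, hy', hz⟩)
        · exact .inl (.inl h)
        · rcases hy.eq_or_lt with rfl | hy
          · exact .inr ⟨h, hj' _ h₃ h₄ hy', hz⟩
          · exact .inl (.inr ⟨h, y, hy, hy', hz⟩)
  · refine ⟨rfl, le_rfl, .refl _ _ _, hAr, hAc, fun i' j' h₁ h₂ h₃ h₄ z => ?_, by omega⟩
    refine ⟨.inl, ?_⟩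
    rintro (h | ⟨-, y, hy, hy', -⟩)
    · exact h
    · have := lt_encode_iff.2 (hy'.trans (hR k k j' m ⟨by omega, by omega⟩
        ⟨by omega, by omega⟩ le_rfl h₄))
      omega

/-- For a row `i` of `L`, and for all values `x` that occur in it, in decreasing order: find the
first column `k` where `L` reaches `x`, and add `x` to the values in row `k` of `R`. Earlier columns
are the better ones, since the entries of `R` decrease in the row number. -/
def valueLoop : Cmd :=
  .loop (.var 7) <|
    .seq (.mincol 8 (.var 3) (.var 6) (.var 7)) <|
    .seq (.entry 9 (.sub (.var 3) (.const 1)) (.var 8) (.var 4)) <|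
    .seq rowLoop
    (.assign 7 (.sub (.var 7) (.const 1)))

theorem valueLoop_spec {s : State} {d m i Y : ℕ} (h3 : s.var 3 = d + 1) (h4 : s.var 4 = m)
    (h6 : s.var 6 = i) (hL : Mat.Monotone (s.mat (d + 1))) (hR : Mat.Monotone (s.mat d))
    (hRr : (s.mat d).rows = m) (hRc : (s.mat d).cols = m)
    (hLr : (s.mat (d + 1)).rows = m) (hLc : (s.mat (d + 1)).cols = m)
    (hAr : (s.mat (d + 2)).rows = m) (hAc : (s.mat (d + 2)).cols = m)
    (hi : 1 ≤ i ∧ i ≤ m) (h7 : s.var 7 = encode ((s.mat (d + 1)).entry i m))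
    (hY : ∀ k, 1 ≤ k → k ≤ m → encode ((s.mat d).entry k m) ≤ Y)
    (hW : d + 2 ≤ W ∧ m ≤ W ∧ s.var 7 + Y ≤ W) :
    WP W adv valueLoop s fun t => Preserves 7 (d + 2) s t ∧
      (t.mat (d + 2)).rows = m ∧ (t.mat (d + 2)).cols = m ∧
      (∀ i' j', 1 ≤ i' → i' ≤ m → 1 ≤ j' → j' ≤ m → ∀ z : ℕ,
        (z : WithBot ℕ) ≤ (t.mat (d + 2)).entry i' j' ↔
          (z : WithBot ℕ) ≤ (s.mat (d + 2)).entry i' j' ∨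
          (i' ≤ i ∧ ∃ k x y : ℕ, 1 ≤ k ∧ k ≤ m ∧ (x : WithBot ℕ) ≤ (s.mat (d + 1)).entry i k ∧
            (y : WithBot ℕ) ≤ (s.mat d).entry k j' ∧ z ≤ x + y)) ∧
      t.steps ≤ s.steps + 2 + (26 * Y + 20) * s.var 7 := by
  -- The values `c ≤ x` have been treated when the counter is `c`.
  refine WP.countdown (fun c t => t.var 7 = c ∧ c ≤ s.var 7 ∧ Preserves 7 (d + 2) s t ∧
      (t.mat (d + 2)).rows = m ∧ (t.mat (d + 2)).cols = m ∧
      (∀ i' j', 1 ≤ i' → i' ≤ m → 1 ≤ j' → j' ≤ m → ∀ z : ℕ,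
        (z : WithBot ℕ) ≤ (t.mat (d + 2)).entry i' j' ↔
          (z : WithBot ℕ) ≤ (s.mat (d + 2)).entry i' j' ∨
          (i' ≤ i ∧ ∃ k x y : ℕ, c ≤ x ∧ 1 ≤ k ∧ k ≤ m ∧
            (x : WithBot ℕ) ≤ (s.mat (d + 1)).entry i k ∧
            (y : WithBot ℕ) ≤ (s.mat d).entry k j' ∧ z ≤ x + y)) ∧
      t.steps + (26 * Y + 20) * c ≤ s.steps + (26 * Y + 20) * s.var 7) ?_ ?_ (s.var 7) ?_
  · rintro t ⟨hv, -, hp, hr, hc, hm, hs⟩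
    refine ⟨hv, ⟨hp.var, hp.arr, hp.mat⟩, hr, hc, ?_, ?_⟩
    · simpa using hm
    · simp at hs ⊢; omega
  · rintro c t ⟨hv, hle, hp, hr, hc, hm, hs⟩
    refine ⟨hv, by omega, ?_⟩
    have t3 : t.var 3 = d + 1 := by rw [hp.var 3 (by omega), h3]
    have t4 : t.var 4 = m := by rw [hp.var 4 (by omega), h4]
    have t6 : t.var 6 = i := by rw [hp.var 6 (by omega), h6]
    have tL : t.mat (d + 1) = s.mat (d + 1) := hp.mat _ (by omega)
    have tR : t.mat d = s.mat d := hp.mat d (by omega)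
    have hex : (c : WithBot ℕ) ≤ (s.mat (d + 1)).entry i m := lt_encode_iff.1 (by omega)
    have hk := Mat.mincol_spec (A := s.mat (d + 1)) (d := adv t.ops) (i := i) (j := m) (x := c)
      (by omega) (by omega) hex
    have hk' : ∀ k', 1 ≤ k' → k' ≤ m → (c : WithBot ℕ) ≤ (s.mat (d + 1)).entry i k' →
        (s.mat (d + 1)).mincol (adv t.ops) i c ≤ k' := fun j' h₁ h₂ h₃ =>
      (Mat.mincol_spec (d := adv t.ops) h₁ (by omega) h₃).2.1
    simp [Nat.add_assoc, t3, t4, t6, tL, tR, hv]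
    generalize (s.mat (d + 1)).mincol (adv t.ops) i c = k at *
    have hYk := hY k (by omega) (by omega)
    and_intros
    any_goals omega
    refine WP.imp (rowLoop_spec (d := d) (m := m) (i := i) (cx := c + 1) (k := k)
      ?_ ?_ ?_ ?_ ?_ ?_ ?_ ?_ ?_ ?_ ?_ ?_ ?_ ?_) ?post
    case post =>
      rintro u ⟨hu, hur, huc, hum, hus⟩
      have u7 : u.var 7 = c + 1 := by rw [hu.var 7 (by omega)]; simp [hv]
      simp [u7, hur, huc, tR] at hus hum ⊢
      rw [Nat.mul_succ] at hs
      and_intros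
      any_goals omega
      · refine (hp.of (fun x hx => ?_) (fun a ha => hu.arr a ha) hu.mat)
        dsimp only
        rw [Function.update_of_ne (by omega), hu.var x (by omega)]
        simp (disch := omega) only [Function.update_of_ne]
      · intro i' j' h₁ h₂ h₃ h₄ z
        rw [hum i' j' h₁ h₂ h₃ h₄, hm i' j' h₁ h₂ h₃ h₄]
        constructor
        · rintro ((h | ⟨h, k', x, y, hx, hr⟩) | ⟨h, y, hy, hz⟩)
          · exact .inl h
          · exact .inr ⟨h, k', x, by omega, hr.1, hr.2.1, hr.2.2.1, y, hr.2.2.2⟩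
          · exact .inr ⟨h, k, c, le_rfl, hk.1, hk.2.1, hk.2.2, y, hy, by omega⟩
        · rintro (h | ⟨h, k', x, hx, hk₁, hk₂, hx', y, hy, hz⟩)
          · exact .inl (.inl h)
          · rcases hx.eq_or_lt with rfl | hx
            · refine .inr ⟨h, y, hy.trans (hR _ _ _ _ ⟨?_, ?_⟩ ⟨?_, ?_⟩ (hk' _ hk₁ hk₂ hx') le_rfl),
                by omega⟩ <;> omega
            · exact .inl (.inr ⟨h, k', x, y, hx, hk₁, hk₂, hx', hy, hz⟩)
    any_goals simp [*]
    any_goals omega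
  · refine ⟨rfl, le_rfl, .refl _ _ _, hAr, hAc, fun i' j' h₁ h₂ h₃ h₄ z => ?_, by omega⟩
    refine ⟨.inl, ?_⟩
    rintro (h | ⟨-, k, x, y, hx, hk, hk', hx', -⟩)
    · exact h
    · have := lt_encode_iff.2 (hx'.trans (hL i i k m ⟨by omega, by omega⟩
        ⟨by omega, by omega⟩ le_rfl hk'))
      omega

/-- For all rows `i` of `L`: find the largest value in the row, in the last column, and run through
the values. -/
def productLoop : Cmd :=
  .loop (.var 6) <|
    .seq (.entry 7 (.var 3) (.var 6) (.var 4)) <|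
    .seq valueLoop
    (.assign 6 (.sub (.var 6) (.const 1)))

theorem productLoop_spec {s : State} {d m X Y : ℕ} (h3 : s.var 3 = d + 1) (h4 : s.var 4 = m)
    (h6 : s.var 6 = m) (hL : Mat.Monotone (s.mat (d + 1))) (hR : Mat.Monotone (s.mat d))
    (hRr : (s.mat d).rows = m) (hRc : (s.mat d).cols = m)
    (hLr : (s.mat (d + 1)).rows = m) (hLc : (s.mat (d + 1)).cols = m)
    (hA : s.mat (d + 2) = Mat.bot m m)
    (hX : ∀ i, 1 ≤ i → i ≤ m → encode ((s.mat (d + 1)).entry i m) ≤ X)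
    (hY : ∀ k, 1 ≤ k → k ≤ m → encode ((s.mat d).entry k m) ≤ Y)
    (hW : d + 2 ≤ W ∧ m ≤ W ∧ X + Y ≤ W) :
    WP W adv productLoop s fun t => Preserves 6 (d + 2) s t ∧
      (t.mat (d + 2)).rows = m ∧ (t.mat (d + 2)).cols = m ∧
      (∀ i j, 1 ≤ i → i ≤ m → 1 ≤ j → j ≤ m → ∀ z : ℕ,
        (z : WithBot ℕ) ≤ (t.mat (d + 2)).entry i j ↔
          ∃ k x y : ℕ, 1 ≤ k ∧ k ≤ m ∧ (x : WithBot ℕ) ≤ (s.mat (d + 1)).entry i k ∧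
            (y : WithBot ℕ) ≤ (s.mat d).entry k j ∧ z ≤ x + y) ∧
      t.steps ≤ s.steps + 2 + ((26 * Y + 20) * X + 20) * m := by
  -- The rows below row `c` have been treated when the counter is `c`.
  refine WP.countdown (fun c t => t.var 6 = c ∧ c ≤ m ∧ Preserves 6 (d + 2) s t ∧
      (t.mat (d + 2)).rows = m ∧ (t.mat (d + 2)).cols = m ∧
      (∀ i j, 1 ≤ i → i ≤ m → 1 ≤ j → j ≤ m → ∀ z : ℕ,
        (z : WithBot ℕ) ≤ (t.mat (d + 2)).entry i j ↔
          ∃ i' k x y : ℕ, c < i' ∧ i ≤ i' ∧ i' ≤ m ∧ 1 ≤ k ∧ k ≤ m ∧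
            (x : WithBot ℕ) ≤ (s.mat (d + 1)).entry i' k ∧
            (y : WithBot ℕ) ≤ (s.mat d).entry k j ∧ z ≤ x + y) ∧
      t.steps + ((26 * Y + 20) * X + 20) * c ≤ s.steps + ((26 * Y + 20) * X + 20) * m)
    ?_ ?_ m ?_
  · rintro t ⟨hv, -, hp, hr, hc, hm, hs⟩
    refine ⟨hv, ⟨hp.var, hp.arr, hp.mat⟩, hr, hc, fun i j h₁ h₂ h₃ h₄ z => ?_, ?_⟩
    · simp only [State.tick]
      rw [hm i j h₁ h₂ h₃ h₄]
      constructor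
      · rintro ⟨i', k, x, y, g₁, g₂, g₃, g₄, g₅, g₆, g₇⟩
        refine ⟨k, x, y, g₄, g₅, g₆.trans (hL _ _ _ _ ⟨?_, ?_⟩ ⟨?_, ?_⟩ g₂ le_rfl), g₇⟩ <;> omega
      · rintro ⟨k, x, y, g⟩
        exact ⟨i, k, x, y, by omega, le_rfl, h₂, g⟩
    · simp at hs ⊢; omega
  · rintro c t ⟨hv, hle, hp, hr, hc, hm, hs⟩
    refine ⟨hv, by omega, ?_⟩
    have t3 : t.var 3 = d + 1 := by rw [hp.var 3 (by omega), h3]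
    have t4 : t.var 4 = m := by rw [hp.var 4 (by omega), h4]
    have tL : t.mat (d + 1) = s.mat (d + 1) := hp.mat _ (by omega)
    have tR : t.mat d = s.mat d := hp.mat d (by omega)
    have hXc := hX (c + 1) (by omega) (by omega)
    simp [Nat.add_assoc, t3, t4, tL, hv]
    and_intros
    any_goals omega
    refine WP.imp (valueLoop_spec (d := d) (m := m) (i := c + 1) (Y := Y)
      ?_ ?_ ?_ ?_ ?_ ?_ ?_ ?_ ?_ ?_ ?_ ?_ ?_ ?_ ?_) ?post
    case post =>
      rintro u ⟨hu, hur, huc, hum, hus⟩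
      have u6 : u.var 6 = c + 1 := by rw [hu.var 6 (by omega)]; simp [hv]
      simp [u6, hur, huc] at hus hum ⊢
      rw [Nat.mul_succ] at hs
      have := Nat.mul_le_mul_left (26 * Y + 20) hXc
      and_intros
      any_goals omega
      · refine (hp.of (fun x hx => ?_) (fun a ha => hu.arr a ha) hu.mat)
        dsimp only
        rw [Function.update_of_ne (by omega), hu.var x (by omega)]
        simp (disch := omega) only [Function.update_of_ne]
      · intro i' j' h₁ h₂ h₃ h₄ z
        rw [hum i' j' h₁ h₂ h₃ h₄, hm i' j' h₁ h₂ h₃ h₄, tL, tR]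
        constructor
        · rintro (⟨i, k, x, y, hx, hr⟩ | ⟨h, k, g₁, g₂, x, g₃, y, g₄, g₅⟩)
          · exact ⟨i, by omega, hr.1, hr.2.1, k, hr.2.2.1, hr.2.2.2.1, x, hr.2.2.2.2.1, y,
              hr.2.2.2.2.2⟩
          · exact ⟨c + 1, by omega, h, hle, k, g₁, g₂, x, g₃, y, g₄, g₅⟩
        · rintro ⟨i, hi, g₁, g₂, k, g₃, g₄, x, g₅, y, g₆, g₇⟩
          rcases (show c + 1 ≤ i from hi).eq_or_lt with rfl | hi
          · exact .inr ⟨g₁, k, g₃, g₄, x, g₅, y, g₆, g₇⟩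
          · exact .inl ⟨i, k, x, y, hi, g₁, g₂, g₃, g₄, g₅, g₆, g₇⟩
    any_goals simp [*]
    any_goals omega
  · refine ⟨h6, le_rfl, .refl _ _ _, by rw [hA]; rfl, by rw [hA]; rfl,
      fun i j h₁ h₂ h₃ h₄ z => ?_, le_rfl⟩
    rw [hA]
    refine ⟨fun h => ?_, fun ⟨i', _, _, _, g₁, _, g₂, _⟩ => by omega⟩
    simp [Mat.bot] at h

/-- Replace the two topmost matrices on the stack by their product. -/
def product : Cmd :=
  .seq (.newMat (.add (.var 3) (.const 1)) (.var 4) (.var 4)) <|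
  .seq (.assign 6 (.var 4)) <|
  .seq productLoop <|
  .seq (.copyMat (.sub (.var 3) (.const 1)) (.add (.var 3) (.const 1)))
  (.assign 3 (.sub (.var 3) (.const 1)))

theorem product_spec {s : State} {d m X Y : ℕ} (h3 : s.var 3 = d + 1) (h4 : s.var 4 = m)
    (hL : Mat.Monotone (s.mat (d + 1))) (hR : Mat.Monotone (s.mat d))
    (hRr : (s.mat d).rows = m) (hRc : (s.mat d).cols = m)
    (hLr : (s.mat (d + 1)).rows = m) (hLc : (s.mat (d + 1)).cols = m)
    (hX : ∀ i, 1 ≤ i → i ≤ m → encode ((s.mat (d + 1)).entry i m) ≤ X)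
    (hY : ∀ k, 1 ≤ k → k ≤ m → encode ((s.mat d).entry k m) ≤ Y)
    (hW : d + 2 ≤ W ∧ m ≤ W ∧ X + Y ≤ W) :
    WP W adv product s fun t => Preserves 3 d s t ∧ t.var 3 = d ∧ t.var 4 = m ∧
      (t.mat d).rows = m ∧ (t.mat d).cols = m ∧
      (∀ i j, 1 ≤ i → i ≤ m → 1 ≤ j → j ≤ m → ∀ z : ℕ,
        (z : WithBot ℕ) ≤ (t.mat d).entry i j ↔
          ∃ k x y : ℕ, 1 ≤ k ∧ k ≤ m ∧ (x : WithBot ℕ) ≤ (s.mat (d + 1)).entry i k ∧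
            (y : WithBot ℕ) ≤ (s.mat d).entry k j ∧ z ≤ x + y) ∧
      t.steps ≤ s.steps + 30 + ((26 * Y + 20) * X + 20) * m := by
  simp [product, Nat.add_assoc, h3, h4]
  and_intros
  any_goals omega
  refine WP.imp (productLoop_spec (d := d) (m := m) (X := X) (Y := Y)
      ?_ ?_ ?_ ?_ ?_ ?_ ?_ ?_ ?_ ?_ ?_ ?_ ?_) ?post
  case post =>
    rintro u ⟨hu, hur, huc, hum, hus⟩
    have u3 : u.var 3 = d + 1 := by rw [hu.var 3 (by omega)]; simp [h3]
    have u4 : u.var 4 = m := by rw [hu.var 4 (by omega)]; simp [h4]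
    simp [u3, u4, hur, huc, Nat.add_assoc] at hus hum ⊢
    and_intros
    any_goals omega
    · refine ⟨fun x hx => ?_, fun a ha => hu.arr a ha, fun g hg => ?_⟩
      · dsimp only
        rw [Function.update_of_ne (by omega), hu.var x (by omega)]
        simp (disch := omega) only [Function.update_of_ne]
      · dsimp only
        rw [Function.update_of_ne (by omega), hu.mat g (by omega)]
        simp (disch := omega) only [Function.update_of_ne]
  any_goals simp [*]
  any_goals omega

/-! ### Similarity matrices in the memory -/

/-- The matrix `A` is the similarity matrix of `F` and `G`. The entries are described by the numbers
below them. -/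
structure IsSim {α : Type} (G F : Forest α) (A : Mat) : Prop where
  rows : A.rows = 2 * G.size + 1
  cols : A.cols = 2 * G.size + 1
  le_iff : ∀ i j, 1 ≤ i → i ≤ 2 * G.size + 1 → 1 ≤ j → j ≤ 2 * G.size + 1 → ∀ x : ℕ,
    (x : WithBot ℕ) ≤ A.entry i j ↔ i ≤ j ∧ Matching F (G.between i j 1) x

namespace IsSim

variable {α : Type} {G F F' : Forest α} {A : Mat}

theorem monotone (h : IsSim G F A) : A.Monotone := by
  intro i i' j j' hij hij' hi hj
  refine forall_le_iff_le.1 fun c hc => ?_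
  simp only [Mat.InRange, h.rows, h.cols] at hij hij'
  cases c with
  | bot => exact bot_le
  | coe x =>
    have := (h.le_iff i j (by omega) (by omega) (by omega) (by omega) x).1 hc
    exact (h.le_iff i' j' (by omega) (by omega) (by omega) (by omega) x).2
      ⟨by omega, this.2.between_mono hi hj⟩

theorem encode_le (h : IsSim G F A) {i j : ℕ} (hi : 1 ≤ i) (hi' : i ≤ 2 * G.size + 1)
    (hj : 1 ≤ j) (hj' : j ≤ 2 * G.size + 1) : encode (A.entry i j) ≤ 2 * F.size + 1 := by
  by_contra hc
  rw [not_le, lt_encode_iff, h.le_iff i j hi hi' hj hj'] at hc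
  have := hc.2.le_two_mul_size
  omega

end IsSim

theorem matching_nil_iff {α : Type} {G : Forest α} {x : ℕ} : Matching .nil G x ↔ x = 0 := by
  refine ⟨fun h => ?_, fun h => h ▸ .nil_zero G⟩
  have := h.le_two_mul_size
  simpa [Forest.size] using this

/-- Put the similarity matrix of the empty forest on the stack. -/
def unitMatrix : Cmd :=
  .seq (.newMat (.var 3) (.var 4) (.var 4)) <|
  .seq (.assign 6 (.var 4)) <|
  .loop (.var 6) <|
    .seq (.rangemax (.var 3) (.var 3) (.var 6) (.var 6) (.const 1))
    (.assign 6 (.sub (.var 6) (.const 1)))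

theorem unitMatrix_spec {α : Type} {G : Forest α} {s : State} {d : ℕ} (h3 : s.var 3 = d)
    (h4 : s.var 4 = 2 * G.size + 1) (hW : d ≤ W ∧ 2 * G.size + 1 ≤ W) :
    WP W adv unitMatrix s fun t => Preserves 6 d s t ∧ IsSim G .nil (t.mat d) ∧
      t.steps ≤ s.steps + 10 + 12 * (2 * G.size + 1) := by
  generalize hm : 2 * G.size + 1 = m at *
  simp [unitMatrix, h3, h4]
  and_intros
  any_goals omega
  -- The diagonal positions below row `c` have been treated when the counter is `c`.
  refine WP.countdown (fun c t => t.var 6 = c ∧ c ≤ m ∧ Preserves 6 d s t ∧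
      (t.mat d).rows = m ∧ (t.mat d).cols = m ∧
      (∀ i j, 1 ≤ i → i ≤ m → 1 ≤ j → j ≤ m → ∀ z : ℕ,
        (z : WithBot ℕ) ≤ (t.mat d).entry i j ↔
          z = 0 ∧ ∃ l, c < l ∧ l ≤ m ∧ i ≤ l ∧ l ≤ j) ∧
      t.steps + 12 * c ≤ s.steps + 8 + 12 * m) ?_ ?_ m ?_
  · rintro t ⟨hv, -, hp, hr, hc, ht, hs⟩
    refine ⟨hv, ⟨hp.var, hp.arr, hp.mat⟩, ⟨by simp; omega, by simp; omega, ?_⟩, by simp; omega⟩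
    rw [hm]
    intro i j h₁ h₂ h₃ h₄ z
    rw [matching_nil_iff]
    refine (ht i j h₁ h₂ h₃ h₄ z).trans ⟨?_, fun h => ⟨h.2, i, by omega, h₂, le_rfl, h.1⟩⟩
    rintro ⟨h, l, hl⟩
    omega
  · rintro c t ⟨hv, hle, hp, hr, hc, ht, hs⟩
    have t3 : t.var 3 = d := by rw [hp.var 3 (by omega), h3]
    refine ⟨hv, by omega, ?_⟩
    simp [t3, hv, hr, hc]
    and_intros
    any_goals omega
    · refine hp.of (fun x hx => ?_) (fun _ _ => rfl) (fun g hg => ?_) <;>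
        simp (disch := omega) only [Function.update_of_ne]
    · intro i j h₁ h₂ h₃ h₄ z
      rw [show (0 : WithBot ℕ) = decode 1 from rfl, Mat.natCast_le_rangemax, ht i j h₁ h₂ h₃ h₄]
      constructor
      · rintro (⟨h, l, hl⟩ | h)
        · exact ⟨h, l, by omega⟩
        · exact ⟨by omega, c + 1, by omega⟩
      · rintro ⟨h, l, hl, hl'⟩
        rcases (show c + 1 ≤ l from hl).eq_or_lt with rfl | hl
        · exact .inr (by omega)
        · exact .inl ⟨h, l, by omega⟩
  · refine ⟨by simp, le_rfl, ⟨fun x hx => ?_, fun _ _ => rfl, fun g hg => ?_⟩, by simp [Mat.bot],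
      by simp [Mat.bot], fun i j h₁ h₂ h₃ h₄ z => ?_, by simp⟩
    · simp (disch := omega) only [Function.update_of_ne]
    · simp (disch := omega) only [Function.update_of_ne]
    · simp only [Mat.bot, Function.update_self, WithBot.natCast_ne_bot, le_bot_iff, false_iff]
      rintro ⟨-, l, hl⟩
      omega

theorem product_isSim {α : Type} {G F F' : Forest α} {s : State} {d : ℕ} (h3 : s.var 3 = d + 1)
    (h4 : s.var 4 = 2 * G.size + 1) (hL : IsSim G F (s.mat (d + 1))) (hR : IsSim G F' (s.mat d))
    (hW : d + 2 ≤ W ∧ 2 * G.size + 1 ≤ W ∧ 2 * F.size + 2 * F'.size + 2 ≤ W) :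
    WP W adv product s fun t => Preserves 3 d s t ∧ t.var 3 = d ∧ t.var 4 = 2 * G.size + 1 ∧
      IsSim G (F.append F') (t.mat d) ∧
      t.steps ≤ s.steps + 30 +
        ((26 * (2 * F'.size + 1) + 20) * (2 * F.size + 1) + 20) * (2 * G.size + 1) := by
  refine WP.imp (product_spec h3 h4 hL.monotone hR.monotone hR.rows hR.cols hL.rows hL.cols
    (fun i h h' => hL.encode_le h h' (by omega) le_rfl)
    (fun i h h' => hR.encode_le h h' (by omega) le_rfl) (by omega)) ?_
  rintro t ⟨hp, t3, t4, hr, hc, ht, hs⟩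
  refine ⟨hp, t3, t4, ⟨hr, hc, fun i j h₁ h₂ h₃ h₄ z => ?_⟩, hs⟩
  rw [ht i j h₁ h₂ h₃ h₄]
  constructor
  · rintro ⟨k, x, y, g₁, g₂, g₃, g₄, g₅⟩
    have k₁ := (hL.le_iff i k h₁ h₂ g₁ g₂ x).1 g₃
    have k₂ := (hR.le_iff k j g₁ g₂ h₃ h₄ y).1 g₄
    exact ⟨by omega, (k₁.2.between_append k₁.1 k₂.1 k₂.2).mono g₅⟩
  · rintro ⟨hij, h⟩
    obtain ⟨k, x, y, g₁, g₂, g₃, g₄, rfl⟩ := h.exists_split hij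
    exact ⟨k, x, y, by omega, by omega,
      (hL.le_iff i k h₁ h₂ (by omega) (by omega) x).2 ⟨g₁, g₃⟩,
      (hR.le_iff k j (by omega) (by omega) h₃ h₄ y).2 ⟨g₂, g₄⟩, le_rfl⟩

variable {σ : ℕ}

/-! ### Adding a root -/

/-- The array `w` holds the encoding of `F` from index `u` on. -/
def TokensAt (w : ℕ → ℕ) : ℕ → Forest (Fin σ) → Prop
  | _, .nil => True
  | u, .cons a c r => w u = a.val + 1 ∧ TokensAt w (u + 1) c ∧ w (u + 2 * c.size + 1) = 0 ∧
      TokensAt w (u + 2 * c.size + 2) r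

/-- The similarity `z` of a tree and of `G[i, j)` can be reached by matching the root, of label `a`,
with a node of the part `H` of `G` that starts at index `u`, and the forest `c` below the root with
what lies below that node. -/
def RootMatch (G c : Forest (Fin σ)) (a : Fin σ) (H : Forest (Fin σ)) (u i j z : ℕ) : Prop :=
  ∃ x f b, H.HasNode x f b (u + 1) ∧ i ≤ x ∧ f < j ∧ ∃ y w, Matching c (G.between (x + 1) f 1) y ∧
    w ≤ 2 ∧ (a ≠ b → w ≤ 1) ∧ z = y + w

theorem rootMatch_cons {G c k r : Forest (Fin σ)} {a b : Fin σ} {u i j z : ℕ} :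
    RootMatch G c a (.cons b k r) u i j z ↔
      (i ≤ u + 1 ∧ u + 2 * k.size + 2 < j ∧
        ∃ y w, Matching c (G.between (u + 2) (u + 2 * k.size + 2) 1) y ∧ w ≤ 2 ∧
          (a ≠ b → w ≤ 1) ∧ z = y + w) ∨
      RootMatch G c a k (u + 1) i j z ∨ RootMatch G c a r (u + 2 * k.size + 2) i j z := by
  have e₁ : u + 1 + 2 * k.size + 2 = u + 2 * k.size + 2 + 1 := by omega
  have e₂ : u + 1 + 2 * k.size + 1 = u + 2 * k.size + 2 := by omega
  constructor
  · rintro ⟨x, f, d, ⟨rfl, rfl, rfl⟩ | h | h, h'⟩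
    · rw [e₂] at h'; exact .inl h'
    · exact .inr (.inl ⟨x, f, d, h, h'⟩)
    · rw [e₁] at h; exact .inr (.inr ⟨x, f, d, h, h'⟩)
  · rintro (h | ⟨x, f, d, h, h'⟩ | ⟨x, f, d, h, h'⟩)
    · exact ⟨u + 1, _, b, .inl ⟨rfl, e₂.symm, rfl⟩, h⟩
    · exact ⟨x, f, d, .inr (.inl h), h'⟩
    · rw [← e₁] at h; exact ⟨x, f, d, .inr (.inr h), h'⟩

/-- The expression by which the program computes the weight of matching nodes with the labels `a` and
`b`, added to the largest weight `v - 1` of a matching of `c` and `G`. -/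
theorem lt_add_weight_iff {c G : Forest (Fin σ)} {a b : Fin σ} {v z : ℕ}
    (hv : ∀ y, y < v ↔ Matching c G y) :
    z < v + 1 + (1 - (a.val - b.val + (b.val - a.val))) ↔
      ∃ y w, Matching c G y ∧ w ≤ 2 ∧ (a ≠ b → w ≤ 1) ∧ z = y + w := by
  have hv0 := (hv 0).2 (matching_iff_le_sim.2 (Nat.zero_le _))
  constructor
  · intro h
    refine ⟨min z (v - 1), z - min z (v - 1), (hv _).1 (by omega), by omega, fun hab => ?_,
      by omega⟩
    have := Fin.val_ne_of_ne hab
    omega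
  · rintro ⟨y, w, hy, hw, hab, rfl⟩
    have := (hv y).2 hy
    by_cases e : a = b
    · subst e; omega
    · have := hab e
      omega

theorem or_shuffle (p q r s : Prop) : ((p ∨ q) ∨ r) ∨ s ↔ p ∨ s ∨ r ∨ q := by tauto

/-- Run through the traversal of `G` from right to left, keeping the exit positions of the open
nodes on a stack. The first `var 12` entries of array `2` are the stack, and variable `11` is the current
index. When the entry of a node is reached, account for matching it with the new root, whose label
is in variable `5`. -/
def rootLoop : Cmd :=
  .loop (.var 11) <|
    .seq (.assign 11 (.sub (.var 11) (.const 1))) <|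
    .cond (.arr 1 (.var 11))
      (.seq (.assign 12 (.sub (.var 12) (.const 1))) <|
        .seq (.entry 13 (.add (.var 3) (.const 1)) (.add (.var 11) (.const 2))
          (.arr 2 (.var 12))) <|
        .rangemax (.var 3) (.var 3) (.add (.var 11) (.const 1))
          (.add (.arr 2 (.var 12)) (.const 1))
          (.add (.add (.var 13) (.const 1)) (.sub (.const 1)
            (.add (.sub (.var 5) (.arr 1 (.var 11))) (.sub (.arr 1 (.var 11)) (.var 5))))))
      (.seq (.store 2 (.var 12) (.add (.var 11) (.const 1)))
        (.assign 12 (.add (.var 12) (.const 1))))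

/-- The loop reaches the left end of the part `H` of `G`, having accounted for the nodes of `H`. What
the loop does from there on is left to the continuation `hR`, so that the statement can be composed
along the recursive structure of `G`. -/
theorem rootLoop_segment {G c : Forest (Fin σ)} {a : Fin σ} {A : Mat} {d : ℕ} {R : State → Prop}
    (hA : IsSim G c A)
    (hW : d + 1 ≤ W ∧ 2 * G.size + 3 ≤ W ∧ 2 * σ ≤ W ∧ 2 * c.size + 3 ≤ W)
    (H : Forest (Fin σ)) (u e : ℕ) (s : State) (hw : TokensAt (s.arr 1) u H)
    (h3 : s.var 3 = d) (h5 : s.var 5 = a.val + 1) (h11 : s.var 11 = u + 2 * H.size)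
    (h12 : s.var 12 = e) (hd : s.mat (d + 1) = A) (hr : (s.mat d).rows = 2 * G.size + 1)
    (hc : (s.mat d).cols = 2 * G.size + 1) (hu : e + u + 2 * H.size ≤ 2 * G.size)
    (hR : ∀ t, Preserves 6 d s t → t.var 11 = u → t.var 12 = e →
      (∀ x < e, t.arr 2 x = s.arr 2 x) → t.mat (d + 1) = A →
      (t.mat d).rows = 2 * G.size + 1 → (t.mat d).cols = 2 * G.size + 1 →
      (∀ i j, ∀ z : ℕ, (z : WithBot ℕ) ≤ (t.mat d).entry i j ↔
        (z : WithBot ℕ) ≤ (s.mat d).entry i j ∨ RootMatch G c a H u i j z) →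
      t.steps ≤ s.steps + 60 * (2 * H.size) → WP W adv rootLoop t R) :
    WP W adv rootLoop s R := by
  induction H generalizing u e s with
  | nil =>
    refine hR s (.refl _ _ _) h11 h12 (fun _ _ => rfl) hd hr hc (fun i j z => ?_) (by omega)
    exact ⟨.inl, fun h => h.elim id fun ⟨_, _, _, h, _⟩ => h.elim⟩
  | cons b k r ihk ihr =>
    obtain ⟨hw₁, hw₂, hw₃, hw₄⟩ := hw
    simp only [Forest.size] at h11 hu hR
    -- The siblings of the leftmost root come first, then the exit from it, the nodes below it, and
    -- the entry to it.
    refine ihr _ e s hw₄ h3 h5 (by omega) h12 hd hr hc (by omega) ?_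
    intro t₁ hp₁ t11 t12 tstack td tr tc tm ts
    have t3 : t₁.var 3 = d := by rw [hp₁.var 3 (by omega), h3]
    have ta : t₁.arr 1 = s.arr 1 := hp₁.arr 1 (by omega)
    refine WP.loop_step (by simp; omega) (by simp; omega) ?_
    simp [t11, ta, hw₃, t12]
    and_intros
    any_goals omega
    refine ihk (u + 1) (e + 1) _ (by simpa [ta] using hw₂) (by simpa using t3)
      (by simp [hp₁.var 5 (by omega), h5]) (by simp; omega) (by simp) (by simpa using td)
      (by simpa using tr) (by simpa using tc) (by omega) ?_
    intro t₂ hp₂ t11' t12' tstack' td' tr' tc' tm' ts'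
    have hp₂' : Preserves 6 d t₁ t₂ := by
      refine ⟨fun x hx => ?_, fun g hg => ?_, fun h hh => hp₂.mat h hh⟩
      · rw [hp₂.var x hx]
        simp (disch := omega) only [Function.update_of_ne]
      · rw [hp₂.arr g hg]
        simp (disch := omega) only [Function.update_of_ne]
    have hp := hp₁.trans hp₂' le_rfl le_rfl
    have t3 : t₂.var 3 = d := by rw [hp.var 3 (by omega), h3]
    have t5 : t₂.var 5 = a.val + 1 := by rw [hp.var 5 (by omega), h5]
    have ta : t₂.arr 1 = s.arr 1 := hp.arr 1 (by omega)
    have te : t₂.arr 2 e = u + 2 * k.size + 2 := by rw [tstack' e (by omega)]; simp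
    refine WP.loop_step (by simp; omega) (by simp; omega) ?_
    have hv := fun y => (lt_encode_iff (a := A.entry (u + 2) (u + 2 * k.size + 2))).trans
      (hA.le_iff (u + 2) (u + 2 * k.size + 2) (by omega) (by omega) (by omega) (by omega) y)
    have hv' := hA.encode_le (i := u + 2) (j := u + 2 * k.size + 2) (by omega) (by omega) (by omega)
      (by omega)
    have hval := hA.rows
    have hvalc := hA.cols
    have ha := a.isLt
    have hb := b.isLt
    simp [t11', ta, hw₁, t12', t3, te, td', tr', tc', t5]
    generalize encode (A.entry (u + 2) (u + 2 * k.size + 2)) = v at *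
    and_intros
    any_goals omega
    refine hR _ ?_ ?_ ?_ ?_ ?_ ?_ ?_ ?_ ?_
    · refine hp.of (fun x hx => ?_) (fun _ _ => rfl) (fun g hg => ?_) <;>
        simp (disch := omega) only [Function.update_of_ne]
    · simp
    · simp
    · intro x hx
      dsimp only
      rw [tstack' x (by omega), ← tstack x hx]
      simp (disch := omega) only [Function.update_self, Function.update_of_ne]
    · simpa using td'
    · simpa using tr'
    · simpa using tc'
    · intro i j z
      simp only [Function.update_self]
      rw [Mat.natCast_le_rangemax, tm' i j z, tm i j z, rootMatch_cons,
        lt_add_weight_iff (c := c) (G := G.between (u + 2) (u + 2 * k.size + 2) 1)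
        fun y => (hv y).trans (and_iff_right (by omega))]
      exact or_shuffle _ _ _ _
    · simp at ts' ⊢
      omega

/-- Replace the similarity matrix of `c` on top of the stack by that of the tree with the forest `c`
below a root whose label is in variable `5`. -/
def addRoot : Cmd :=
  .seq (.copyMat (.add (.var 3) (.const 1)) (.var 3)) <|
  .seq (.assign 11 (.var 1)) <|
  .seq (.assign 12 (.const 0)) rootLoop

theorem addRoot_spec {G c : Forest (Fin σ)} {a : Fin σ} {d : ℕ} {s : State}
    (hA : IsSim G c (s.mat d)) (hw : TokensAt (s.arr 1) 0 G) (h1 : s.var 1 = 2 * G.size)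
    (h3 : s.var 3 = d) (h5 : s.var 5 = a.val + 1)
    (hW : d + 1 ≤ W ∧ 2 * G.size + 3 ≤ W ∧ 2 * σ ≤ W ∧ 2 * c.size + 3 ≤ W) :
    WP W adv addRoot s fun t => Preserves 6 d s t ∧ IsSim G (.cons a c .nil) (t.mat d) ∧
      t.steps ≤ s.steps + 20 + 60 * (2 * G.size) := by
  simp [addRoot, h1, h3]
  and_intros
  any_goals omega
  refine rootLoop_segment (d := d) hA hW G 0 0 _ (by simpa using hw) (by simpa using h3)
    (by simpa using h5) (by simp) (by simp) (by simp) (by simpa using hA.rows)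
    (by simpa using hA.cols) (by omega) ?_
  intro t hp t11 _ _ _ tr tc tm ts
  refine WP.loop_done (by simp [t11]) (by simp [t11])
    ⟨?_, ⟨tr, tc, fun i j h₁ h₂ h₃ h₄ z => ?_⟩, ?_⟩
  · refine Preserves.trans (V' := 6) (D' := d) ?_ (hp.of (fun _ _ => rfl) (fun _ _ => rfl)
      (fun _ _ => rfl)) le_rfl le_rfl
    refine ⟨fun x hx => ?_, fun _ _ => rfl, fun g hg => ?_⟩ <;>
      simp (disch := omega) only [Function.update_of_ne]
  · refine (tm i j z).trans ?_
    rw [matching_tree_iff]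
    simp (disch := omega) only [Function.update_of_ne]
    rw [hA.le_iff i j h₁ h₂ h₃ h₄]
    constructor
    · rintro (⟨h, h'⟩ | ⟨x, f, b, hn, hi, hj, h⟩)
      · exact ⟨h, .inl h'⟩
      · have := hn.bounds
        exact ⟨by omega, .inr ⟨x, f, b, hn, hi, hj, h⟩⟩
    · rintro ⟨h, h' | h'⟩
      · exact .inl ⟨h, h'⟩
      · exact .inr h'
  · simp at ts ⊢; omega

/-! ### The program -/

/-- Run through the traversal of `F` from right to left. Variable `2` is the current index, and
variable `3` is the number of open nodes. On the stack, there is for each open node, and for the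
root level, the similarity matrix of the forest of those children that have been completed. -/
def forestLoop : Cmd :=
  .loop (.var 2) <|
    .seq (.assign 2 (.sub (.var 2) (.const 1))) <|
    .cond (.arr 0 (.var 2))
      (.seq (.assign 5 (.arr 0 (.var 2))) <| .seq addRoot product)
      (.seq (.assign 3 (.add (.var 3) (.const 1))) unitMatrix)

/-- A bound on the time for a forest of `n` nodes, where `m` is the number of rows. -/
def forestCost (m n : ℕ) : ℕ := 200 * m * (n + 1) ^ 2

/-- The cost of a product is proportional to the number of pairs of nodes, one from each factor, and
this is what the squares gain when the two forests are joined. -/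
theorem forestCost_step (m A B : ℕ) (hm : 1 ≤ m) :
    forestCost m B + (40 * m + (forestCost m A + (120 * m + 90 +
      ((26 * (2 * B + 1) + 20) * (2 * (A + 1) + 1) + 20) * m))) ≤
    forestCost m (A + 1 + B) + forestCost m 0 := by
  have h : (26 * (2 * B + 1) + 20) * (2 * (A + 1) + 1) ≤ (52 * (B + 1)) * (3 * (A + 1)) :=
    Nat.mul_le_mul (by omega) (by omega)
  have h₁ : 1 ≤ (A + 1) * (B + 1) := Nat.mul_pos (by omega) (by omega)
  have h₂ : 90 + 40 + 120 + ((26 * (2 * B + 1) + 20) * (2 * (A + 1) + 1) + 20) ≤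
      400 * ((A + 1) * (B + 1)) + 200 := by nlinarith
  have h₃ := Nat.mul_le_mul_right m h₂
  unfold forestCost
  nlinarith

/-- Suppose that the top of the stack is the matrix of a forest `rest`, and that the traversal of `H`
comes next. Then the loop reaches the left end of that traversal with the matrix of `H.append rest`
on top of the stack. As in `rootLoop_segment`, the rest of the run is left to the continuation `hR`.
The bound `hd` ensures that the stack does not outgrow the words. -/
theorem forestLoop_segment {G : Forest (Fin σ)} {N : ℕ} {R : State → Prop}
    (hW : 2 * N + 2 * G.size + 2 * σ + 10 ≤ W) (H rest : Forest (Fin σ)) (u d : ℕ) (s : State)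
    (hw : TokensAt (s.arr 0) u H) (hG : TokensAt (s.arr 1) 0 G) (h1 : s.var 1 = 2 * G.size)
    (h2 : s.var 2 = u + 2 * H.size) (h3 : s.var 3 = d) (h4 : s.var 4 = 2 * G.size + 1)
    (hs : IsSim G rest (s.mat d)) (hd : d + u + 2 * H.size ≤ 2 * N) (hN : H.size + rest.size ≤ N)
    (hR : ∀ t, Preserves 2 d s t → t.var 2 = u → t.var 3 = d → t.var 4 = 2 * G.size + 1 →
      IsSim G (H.append rest) (t.mat d) →
      t.steps + forestCost (2 * G.size + 1) rest.size ≤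
        s.steps + forestCost (2 * G.size + 1) (H.size + rest.size) → WP W adv forestLoop t R) :
    WP W adv forestLoop s R := by
  induction H generalizing rest u d s R with
  | nil =>
    refine hR s (.refl _ _ _) h2 h3 h4 hs ?_
    simp [Forest.size]
  | cons a c r ihc ihr =>
    obtain ⟨hw₁, hw₂, hw₃, hw₄⟩ := hw
    simp only [Forest.size] at h2 hd hR hN
    have ha := a.isLt
    -- The siblings of the leftmost root are added to `rest`; the forest below that root is treated
    -- one level higher on the stack, starting from the empty forest.
    refine ihr rest _ d s hw₄ hG h1 (by omega) h3 h4 hs (by omega) (by omega) ?_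
    intro t₁ hp₁ k2 k3 k4 ks kt
    refine WP.loop_step (by simp; omega) (by simp; omega) ?_
    have k0 : t₁.arr 0 = s.arr 0 := hp₁.arr 0 (by omega)
    simp [k2, k3, k0, hw₃]
    and_intros
    any_goals omega
    refine WP.imp (unitMatrix_spec (G := G) (d := d + 1) (by simp) (by simpa using k4)
      (by omega)) ?_
    rintro t₂ ⟨hp₂, ls, lt⟩
    have l1 : t₂.var 1 = 2 * G.size := by
      rw [hp₂.var 1 (by omega), ← h1, ← hp₁.var 1 (by omega)]; simp
    have l2 : t₂.var 2 = u + 2 * c.size + 1 := by rw [hp₂.var 2 (by omega)]; simp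
    have l3 : t₂.var 3 = d + 1 := by rw [hp₂.var 3 (by omega)]; simp
    have l4 : t₂.var 4 = 2 * G.size + 1 := by rw [hp₂.var 4 (by omega)]; simpa using k4
    have la : ∀ g < 2, t₂.arr g = s.arr g := fun g hg =>
      (hp₂.arr g hg).trans (hp₁.arr g hg)
    have lm : ∀ g < d + 1, t₂.mat g = t₁.mat g := hp₂.mat
    have l0 : t₂.var 0 = s.var 0 := by
      rw [hp₂.var 0 (by omega), ← hp₁.var 0 (by omega)]; simp
    simp at lt
    clear hp₂
    refine ihc .nil (u + 1) (d + 1) t₂ (by rwa [la 0 (by omega)]) (by rwa [la 1 (by omega)]) l1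
      (by omega) l3 l4 ls (by omega) (by simp only [Forest.size]; omega) ?_
    intro t₃ hp₃ m2 m3 m4 ms mt
    rw [Forest.append_nil] at ms
    have m1 : t₃.var 1 = 2 * G.size := by rw [hp₃.var 1 (by omega), l1]
    have ma : ∀ g < 2, t₃.arr g = s.arr g := fun g hg => (hp₃.arr g hg).trans (la g hg)
    have ma0 := ma 0 (by omega)
    have md : IsSim G (r.append rest) (t₃.mat d) := by
      rwa [hp₃.mat d (by omega), lm d (by omega)]
    refine WP.loop_step (by simp; omega) (by simp; omega) ?_
    simp [m2, ma0, hw₁]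
    and_intros
    any_goals omega
    refine WP.imp (addRoot_spec (G := G) (c := c) (a := a) (d := d + 1) (by simpa using ms)
      (by simpa [ma 1 (by omega)] using hG) (by simpa using m1) (by simpa using m3) (by simp)
      (by omega)) ?_
    rintro t₄ ⟨hp₄, ns, nt⟩
    have n3 : t₄.var 3 = d + 1 := by rw [hp₄.var 3 (by omega)]; simpa using m3
    have n4 : t₄.var 4 = 2 * G.size + 1 := by rw [hp₄.var 4 (by omega)]; simpa using m4
    have nd : IsSim G (r.append rest) (t₄.mat d) := by
      rw [hp₄.mat d (by omega)]; exact md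
    refine WP.imp (product_isSim n3 n4 ns nd (by
      simp only [Forest.size, Forest.size_append]; omega)) ?_
    rintro t₅ ⟨hp₅, o3, o4, os, ot⟩
    refine hR t₅ ⟨fun x hx => ?_, fun g hg => ?_, fun g hg => ?_⟩ ?_ o3 o4 os ?_
    · rw [hp₅.var x (by omega), hp₄.var x (by omega)]
      simp (disch := omega) only [Function.update_of_ne]
      rw [hp₃.var x (by omega)]
      obtain rfl | rfl : x = 0 ∨ x = 1 := by omega
      · exact l0
      · rw [l1, h1]
    · rw [hp₅.arr g hg, hp₄.arr g hg]
      exact ma g hg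
    · rw [hp₅.mat g hg, hp₄.mat g (by omega)]
      exact (hp₃.mat g (by omega)).trans ((lm g (by omega)).trans (hp₁.mat g hg))
    · rw [hp₅.var 2 (by omega), hp₄.var 2 (by omega)]
      simp
    · have key := forestCost_step (2 * G.size + 1) c.size (r.size + rest.size) (by omega)
      simp only [Forest.size, Forest.size_append, add_zero] at *
      rw [show c.size + r.size + 1 + rest.size = c.size + 1 + (r.size + rest.size) by omega]
      omega

theorem length_tokens (F : Forest (Fin σ)) : (tokens F).length = 2 * F.size := by
  induction F with
  | nil => rfl
  | cons a c r ihc ihr => simp [tokens, Forest.size, ihc, ihr]; ring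

theorem tokensAt_of_getD {w : ℕ → ℕ} {u : ℕ} {F : Forest (Fin σ)}
    (h : ∀ x < 2 * F.size, w (u + x) = (tokens F).getD x 0) : TokensAt w u F := by
  induction F generalizing u with
  | nil => trivial
  | cons a c r ihc ihr =>
    simp only [Forest.size, tokens] at h
    have hl := length_tokens c
    refine ⟨?_, ihc fun x hx => ?_, ?_, ihr fun x hx => ?_⟩
    · simpa using h 0 (by omega)
    · rw [show u + 1 + x = u + (x + 1) by omega, h _ (by omega), List.getD_cons_succ,
        List.getD_append _ _ _ _ (by omega)]
    · rw [show u + 2 * c.size + 1 = u + (2 * c.size + 1) by omega, h _ (by omega),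
        List.getD_cons_succ, List.getD_append_right _ _ _ _ (by omega)]
      simp [hl]
    · rw [show u + 2 * c.size + 2 + x = u + (2 * c.size + (x + 1) + 1) by omega, h _ (by omega),
        List.getD_cons_succ, List.getD_append_right _ _ _ _ (by omega), hl,
        Nat.add_sub_cancel_left, List.getD_cons_succ]

/-- Halve the number in variable `14`. -/
def halve : Cmd :=
  .loop (.var 14) <|
    .seq (.assign 15 (.add (.var 15) (.const 1)))
    (.assign 14 (.sub (.var 14) (.const 2)))

theorem halve_spec {n : ℕ} {s : State} (h : s.var 14 = 2 * n) (hW : s.var 15 + 2 * n + 2 ≤ W) :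
    WP W adv halve s fun t => t.var 15 = s.var 15 + n ∧ t.var 3 = s.var 3 ∧ t.var 4 = s.var 4 ∧
      t.mat = s.mat ∧ t.steps ≤ s.steps + 2 + 10 * n := by
  induction n generalizing s with
  | zero => exact WP.loop_done (by simp [h]) (by simpa using h) (by simp)
  | succ n ih =>
    refine WP.loop_step (by simp [h]; omega) (by simp [h]) ?_
    simp [h]
    and_intros
    any_goals omega
    refine (ih (by simp; omega) (by simp; omega)).imp ?_
    rintro t ⟨h₁, h₂, h₃, h₄, h₅⟩
    simp at h₁ h₂ h₃ h₅
    exact ⟨by omega, h₂, h₃, h₄, by omega⟩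

/-- Compute the similarity matrix, and from its entry for all of `G` the edit distance. -/
def treeEditDistance : Cmd :=
  .seq (.assign 4 (.add (.var 1) (.const 1))) <|
  .seq (.assign 2 (.var 0)) <|
  .seq unitMatrix <|
  .seq forestLoop <|
  .seq (.assign 14 (.add (.var 0) (.var 1))) <|
  .seq (.assign 15 (.const 0)) <|
  .seq halve <|
  .seq (.entry 13 (.var 3) (.const 1) (.var 4))
  (.assign 0 (.sub (.add (.var 15) (.const 1)) (.var 13)))

theorem IsSim.encode_entry {G F : Forest (Fin σ)} {A : Mat} (h : IsSim G F A) :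
    encode (A.entry 1 (2 * G.size + 1)) = sim F G + 1 := by
  refine eq_of_forall_lt_iff fun x => ?_
  rw [lt_encode_iff, h.le_iff _ _ le_rfl (by omega) (by omega) le_rfl,
    Forest.between_eq_self le_rfl (by omega), matching_iff_le_sim]
  omega

theorem IsSim.same {G F : Forest (Fin σ)} {A : Mat} (h : IsSim G F A) :
    A.Same (simMatrix F G) := by
  refine ⟨h.rows, h.cols, fun i j hij => withBot_ext fun x => ?_⟩
  simp only [Mat.InRange, h.rows, h.cols] at hij
  rw [h.le_iff i j (by omega) (by omega) (by omega) (by omega), simMatrix]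
  dsimp only
  split_ifs with hle
  · rw [Forest.sub_eq_between G (by omega) (by omega), matching_iff_le_sim]
    simp [hle, Nat.cast_withBot, WithBot.coe_le_coe]
  · simp [hle]

theorem treeEditDistance_spec (F G : Forest (Fin σ))
    (hW : 2 * F.size + 2 * G.size + 2 * σ + 10 ≤ W) :
    WP W adv treeEditDistance (initState F G) fun t => IsSim G F (t.mat 0) ∧
      t.var 0 = ed F G ∧ t.steps ≤ 100 + 12 * (2 * G.size + 1) +
        forestCost (2 * G.size + 1) F.size + 10 * (F.size + G.size) := by
  have hF := length_tokens F
  have hG := length_tokens G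
  have i0 : (initState F G).var 0 = 2 * F.size := by simp [initState, hF]
  have i1 : (initState F G).var 1 = 2 * G.size := by simp [initState, hG]
  have i3 : (initState F G).var 3 = 0 := by simp [initState]
  have is : (initState F G).steps = 0 := rfl
  have a0 : TokensAt ((initState F G).arr 0) 0 F :=
    tokensAt_of_getD fun x _ => by simp [initState]
  have a1 : TokensAt ((initState F G).arr 1) 0 G :=
    tokensAt_of_getD fun x _ => by simp [initState]
  generalize initState F G = s at *
  simp [treeEditDistance, i0, i1]
  and_intros
  any_goals omega
  refine (unitMatrix_spec (G := G) (d := 0) (by simpa using i3) (by simp) (by omega)).imp ?_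
  rintro t₁ ⟨hp₁, ks, kt⟩
  have k0 := hp₁.var 0 (by omega)
  have k1 := hp₁.var 1 (by omega)
  have k2 := hp₁.var 2 (by omega)
  have k3 := hp₁.var 3 (by omega)
  have k4 := hp₁.var 4 (by omega)
  simp [i0, i1, i3, is] at k0 k1 k2 k3 k4 kt
  refine forestLoop_segment (G := G) (N := F.size) (by omega) F .nil 0 0 t₁
    (by simpa [hp₁.arr 0 (by omega)] using a0) (by simpa [hp₁.arr 1 (by omega)] using a1)
    k1 (by omega) k3 k4 ks (by omega) (by simp [Forest.size]) ?_
  intro t₂ hp₂ l2 l3 l4 ls lt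
  rw [Forest.append_nil] at ls
  have l0 : t₂.var 0 = 2 * F.size := by rw [hp₂.var 0 (by omega), k0]
  have l1 : t₂.var 1 = 2 * G.size := by rw [hp₂.var 1 (by omega), k1]
  refine WP.loop_done (by simp [l2]) (by simp [l2]) ?_
  simp [l0, l1]
  and_intros
  any_goals omega
  refine (halve_spec (n := F.size + G.size) (by simp; omega) (by simp; omega)).imp ?_
  rintro t₃ ⟨m15, m3, m4, mm, mt⟩
  simp [l3, l4] at m15 m3 m4 mm mt
  have he := ls.encode_entry
  have hr := ls.rows
  have hc := ls.cols
  have hsim : sim F G ≤ F.size + G.size := Nat.sub_le _ _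
  have hed : ed F G ≤ F.size + G.size := ed_le F G
  simp [m3, m4, mm, m15, he, hr, hc]
  simp only [Forest.size, add_zero] at lt
  and_intros
  any_goals omega
  rw [sim]; omega

/-- The running time, up to the cost of the range operations and range queries. -/
theorem time_le (f g : ℕ) : 100 + 12 * (2 * g + 1) + forestCost (2 * g + 1) f + 10 * (f + g) ≤
    3000 * (max f 1 ^ 2 * max g 1) := by
  have hf : 1 ≤ max f 1 := le_max_right _ _
  have hg : 1 ≤ max g 1 := le_max_right _ _
  have hf' : f ≤ max f 1 := le_max_left _ _
  have hg' : g ≤ max g 1 := le_max_left _ _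
  generalize max f 1 = x at *
  generalize max g 1 = y at *
  have h₁ : forestCost (2 * g + 1) f ≤ 200 * (3 * y) * (2 * x) ^ 2 := by
    unfold forestCost
    gcongr <;> omega
  have h₂ : x ≤ x ^ 2 * y := by nlinarith [Nat.mul_le_mul hf hg]
  have h₃ : y ≤ x ^ 2 * y := Nat.le_mul_of_pos_left y (by positivity)
  nlinarith

theorem subPoly_const_mul_one_add {τ : ℕ → ℕ} (hτ : SubPoly fun n => (τ n : ℝ)) (C : ℝ) :
    SubPoly fun n => C * (1 + (τ n : ℝ)) := by
  intro ε hε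
  refine Asymptotics.IsBigO.const_mul_left (Asymptotics.IsBigO.add ?_ (hτ ε hε)) C
  refine Asymptotics.IsBigO.of_bound 1 ?_
  filter_upwards [Filter.eventually_ge_atTop 1] with n hn
  have : (1 : ℝ) ≤ (n : ℝ) ^ ε := Real.one_le_rpow (by exact_mod_cast hn) hε.le
  rw [one_mul, norm_one, Real.norm_of_nonneg (by positivity)]
  exact this

end TED

theorem mainTheorem4 :
    ∃ (P : TED.Cmd) (c k : ℕ), ∀ τ : ℕ → ℕ, TED.SubPoly (fun n => (τ n : ℝ)) →
      ∃ g : ℕ → ℝ, TED.SubPoly g ∧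
        ∀ (σ : ℕ) (F T₂ : TED.Forest (Fin σ)) (adv : ℕ → ℕ), ∃ s : TED.State,
          TED.Exec (c * (F.size + T₂.size + σ + 1) ^ k) adv P (TED.initState F T₂) s ∧
          (s.mat 0).Same (TED.simMatrix F T₂) ∧
          s.var 0 = TED.ed F T₂ ∧
          (s.steps : ℝ) + (τ (F.size + T₂.size) : ℝ) * (s.ops : ℝ) ≤
            g (F.size + T₂.size) * (max F.size 1 : ℝ) ^ 2 * (max T₂.size 1 : ℝ) := by
  refine ⟨TED.treeEditDistance, 10, 1, fun τ hτ => ⟨_, TED.subPoly_const_mul_one_add hτ 3000, ?_⟩⟩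
  intro σ F G adv
  obtain ⟨s, hs, hm, hv, ht⟩ := TED.treeEditDistance_spec (adv := adv)
    (W := 10 * (F.size + G.size + σ + 1) ^ 1) F G (by rw [pow_one]; omega)
  refine ⟨s, hs, hm.same, hv, ?_⟩
  have ho : s.ops ≤ s.steps := by
    have := hs.ops_le
    simpa [TED.initState] using this
  have hb : (s.steps : ℝ) ≤ 3000 * ((max F.size 1 : ℝ) ^ 2 * (max G.size 1 : ℝ)) := by
    exact_mod_cast ht.trans (TED.time_le F.size G.size)
  have ho' : (s.ops : ℝ) ≤ s.steps := by exact_mod_cast ho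
  calc (s.steps : ℝ) + (τ (F.size + G.size) : ℝ) * (s.ops : ℝ)
      ≤ s.steps + (τ (F.size + G.size) : ℝ) * s.steps := by gcongr
    _ = (1 + (τ (F.size + G.size) : ℝ)) * s.steps := by ring
    _ ≤ (1 + (τ (F.size + G.size) : ℝ)) *
        (3000 * ((max F.size 1 : ℝ) ^ 2 * (max G.size 1 : ℝ))) := by gcongr
    _ = _ := by ring
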